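/- **Setting.** Let $N\ge 1$ and $K\in\mathbb N\cup\{\infty\}$. For $I\in\mathbb N^N$ write $|I|=\sum_j i_j$, $I!=\prod_j i_j!$. For a symmetric $B\in\mathbb R^{N\times N}$ let $B_I$ be the $|I|\times|I|$ matrix in which the $j$-th row and column of $B$ are repeated $i_j$ times, and $\mathrm{Haf}(M)=\frac1{m!2^m}\sum_{\sigma\in S_{2m}}\prod_{j=1}^m M_{\sigma(2j-1),\sigma(2j)}$ for $M$ of size $2m\times 2m$ ($\mathrm{Haf}=1$ for the empty matrix and $0$ for odd size). Let $\mathcal B$ be the space of symmetric $N\times N$ matrices with strictly positive entries and all eigenvalues $\lambda_1,\dots,\lambda_N$ in $(0,1)$; for $B\in\mathcal B$ let $b_{\min}$ be its smallest entry and $d=\prod_j\sqrt{1-\lambda_j^2}$. Let $\mathcal A=\prod_{0\le k\le K}\mathbb R_{\ge0}^{\{|I|=2k\}}$ with the product topology. For $a\in\mathcal A$ put (all sums over $I,J$ of even degree at most $2K$) $$\mu=\sum_I a_I\mathrm{Haf}(B_I),\quad Q^{\mathrm{GBS\text{-}P}}=\frac1d\sum_{I,J}a_Ia_J\,J!\,\frac{\mathrm{Haf}(B_I)}{\mathrm{Haf}(B_J)},\quad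 Q^{\mathrm{MC}}=\sum_{I,J}a_Ia_J\mathrm{Haf}(B_{I+J}).$$ The problem space $\mathcal P\subseteq\mathcal B\times\mathcal A$ consists of the pairs $(B,a)$ with $\mu\ne0$ for which $\mu$, $\sum_I a_I I!/\mathrm{Haf}(B_I)$ and $Q^{\mathrm{MC}}$ are finite, with the subspace topology. For $0<\epsilon,\delta<1$ the guaranteed sample sizes are $$n^{\mathrm{GBS\text{-}P}}_{\mathrm{Haf}}=\frac{Q^{\mathrm{GBS\text{-}P}}-\mu^2}{\delta\epsilon^2\mu^2},\qquad n^{\mathrm{MC}}_{\mathrm{Haf}}=\frac{Q^{\mathrm{MC}}-\mu^2}{\delta\epsilon^2\mu^2}.$$ For $k\ge1$ write $2k=Ns_k+r_k$ with $1\le r_k\le N$, $s_\infty=\infty$, and $m_k=(s_k!)^N(s_k+1)^{r_k}$. Let $\mathrm{Li}_{s,K}(z)=\sum_{k=1}^K z^k/k^s$, $q^-=\min(q,0)$, $$G_{q,K,N}(z)=\sum_{k=1}^{\lfloor N/2\rfloor}\frac{k^q z^{2k}}{(2k)!}+2^{\frac{N-1}2-q^-}\pi^{\frac{N-1}2}N^{q-\frac12}e^{\frac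 N{12}}\,\mathrm{Li}_{0,N}\!\Big(\frac{2z}N\Big)\,\mathrm{Li}_{\frac12-\frac N2-q,\,s_K}\!\Big(\frac{z^N}{N^N}\Big),$$ and $R_{q,K}(z)=\frac{2^{-q}}{2\sqrt\pi}\mathrm{Li}_{\frac12-q,K}(z)$ if $q\ge0$, $R_{q,K}(z)=\frac1{2\sqrt\pi}\mathrm{Li}_{\frac12-2q,K}(z)$ if $q<0$. Let $\zeta,p,\gamma_\alpha,\gamma_\beta,C_G,C_D>0$, $C_R>1$, $q_\alpha,q_\beta\in\mathbb R$. Let $\mathcal B''_{\alpha,\beta}$ be the set of $B\in\mathcal B$ with $$G_{q_\beta,K,N}\big(\sqrt{2\gamma_\beta b_{\min}^{-1}}\big)<C_GN^3,\quad R_{q_\alpha,K}(4\gamma_\alpha b_{\min})>\tfrac1{2\sqrt\pi}(\zeta N^2)^{2q_\alpha-\frac12}C_R^{\zeta N^2},\quad \tfrac1d<C_DN^p,$$ where, if $K=\infty$, also $\sqrt{2\gamma_\beta b_{\min}^{-1}}<N$ and $4\gamma_\alpha b_{\min}<1$, so that $G$ and $R$ are defined. Call $(*)$ the conditions, for all $1\le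 k\le K$, $$\frac{k^{q_\alpha}\gamma_\alpha^k}{k!}\le\sum_{|I|=2k}a_I\le\frac{k^{q_\beta}\gamma_\beta^k}{k!},\qquad \sum_{|I|=2k}a_I\,I!\le\frac{k^{q_\beta}\gamma_\beta^k}{k!}\,m_k .$$ **Theorem.** (1) Let $N\ge1$, $K\ge\zeta N^2$ (possibly $K=\infty$), $0<\epsilon,\delta<1$. If $(B,a)\in\mathcal P$, $B\in\mathcal B''_{\alpha,\beta}$, $a$ satisfies $(*)$ and $a_0\ne0$, then $$n^{\mathrm{GBS\text{-}P}}_{\mathrm{Haf}}<\frac1{\epsilon^2\delta}\Big(C_DN^p+\frac{C_GC_DN^{3+p}}{a_0}-1\Big),$$ $$n^{\mathrm{MC}}_{\mathrm{Haf}}>\frac1{\epsilon^2\delta}\left(\frac{\min(1,a_0)\,\frac{e^{\frac1{25}-\frac16}}{\sqrt\pi}\,(\zeta N^2)^{2q_\alpha-\frac12}C_R^{\zeta N^2}}{\big(C_DN^p(a_0+C_GN^3)\big)^2}-1\right).$$ (2) Fix $\zeta,p,C_G,C_D,C_R$ and $0<l\le u$, and let $q_\alpha=q_\alpha(N)$ be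 such that $C_R^{\zeta N^2}$ dominates $(\zeta N^2)^{2q_\alpha-\frac12}C_R^{\zeta N^2}$, in the sense that $(2q_\alpha(N)-\frac12)\log(\zeta N^2)=o(N^2)$. Then there is $C>0$, and for every $1<\rho<C_R$ there are $c>0$ and $N_0$, such that for all $N\ge N_0$, all $K\ge\zeta N^2$, all $0<\epsilon,\delta<1$, $\gamma_\alpha,\gamma_\beta>0$, $q_\beta$, and all $(B,a)$ as in (1) with $l\le a_0\le u$, $$n^{\mathrm{GBS\text{-}P}}_{\mathrm{Haf}}\le\frac1{\epsilon^2\delta}\,C\,N^{3+p},\qquad n^{\mathrm{MC}}_{\mathrm{Haf}}\ge\frac1{\epsilon^2\delta}\,c\,\rho^{\zeta N^2}.$$ (3) For all $\zeta,p>0$ there are constants $C_G,C_D>0$, $C_R>1$ and sequences $\gamma_\alpha(N),\gamma_\beta(N)>0$, $q_\alpha(N),q_\beta(N)$, with $q_\alpha$ as in (2), such that for all $0<l<u$ there are $C,c>0$ and $N_0$ with the following property. For all $N\ge N_0$ and all finite $K\ge\zeta N^2$ there is a non-empty open subset $U$ of $\mathcal P$ such that every $(B,a)\in U$ satisfies $B\in\mathcal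 B''_{\alpha,\beta}$, $(*)$ and $l<a_0<u$, and, for all $0<\epsilon,\delta<1$, $$n^{\mathrm{GBS\text{-}P}}_{\mathrm{Haf}}\le\frac1{\epsilon^2\delta}\,C\,N^{3+p},\qquad n^{\mathrm{MC}}_{\mathrm{Haf}}\ge\frac1{\epsilon^2\delta}\,c\,C_R^{\zeta N^2};$$ moreover every value in $(l,u)$ is attained as $a_0$ for some $(B,a)\in U$. -/

import Mathlib

open scoped NNReal Topology

namespace GBS

noncomputable section

/-- The hafnian of a square matrix indexed by a finite type `ι`. With `m = ⌊card ι / 2⌋` it is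
`(1 / (m! 2^m)) ∑_σ ∏_{j < m} M (σ (2j)) (σ (2j+1))`, where `σ` runs over the bijections
`{0, …, 2m-1} ≃ ι` (for `ι = Fin (2m)`: the permutations). It is `1` for the empty matrix, and
it is `0` if `card ι` is odd, as there are then no such bijections. -/
def hafnian {ι : Type} [Fintype ι] [DecidableEq ι] (M : Matrix ι ι ℝ) : ℝ :=
  (1 / ((Nat.factorial (Fintype.card ι / 2) : ℝ) * 2 ^ (Fintype.card ι / 2))) *
    ∑ σ : Fin (2 * (Fintype.card ι / 2)) ≃ ι,
      ∏ j : Fin (Fintype.card ι / 2),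
        M (σ ⟨2 * j.1, by have := j.2; omega⟩) (σ ⟨2 * j.1 + 1, by have := j.2; omega⟩)

/-- `Haf(B_I)`: the matrix `B_I` repeats the `i`-th row and column of `B` exactly `I i` times. -/
def hafB {N : ℕ} (B : Matrix (Fin N) (Fin N) ℝ) (I : Fin N → ℕ) : ℝ :=
  hafnian (B.submatrix (Sigma.fst : (Σ i : Fin N, Fin (I i)) → Fin N)
    (Sigma.fst : (Σ i : Fin N, Fin (I i)) → Fin N))

/-- `I! = i₁! ⋯ i_N!`. -/
def mfact {N : ℕ} (I : Fin N → ℕ) : ℝ := ∏ i, (Nat.factorial (I i) : ℝ)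

/-- The multi-indices `I` with `|I| = 2k`. -/
def level (N k : ℕ) : Finset (Fin N → ℕ) := Finset.piAntidiag Finset.univ (2 * k)

/-- The multi-indices `I` with `|I| = 2k` for some `k ≤ K` (`K` a natural number or `∞`). -/
abbrev EvenIdx (N : ℕ) (K : ℕ∞) : Type :=
  {I : Fin N → ℕ // ∃ k : ℕ, (k : ℕ∞) ≤ K ∧ ∑ i, I i = 2 * k}

/-- The space `𝒜 = ∏_{k ≤ K} ℝ_{≥0}^{I : |I| = 2k}` with the product topology. -/
abbrev CoeffSpace (N : ℕ) (K : ℕ∞) : Type := EvenIdx N K → ℝ≥0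

open Classical in
/-- The coefficient `a_I`, read as `0` for multi-indices that do not occur. -/
def coeff {N : ℕ} {K : ℕ∞} (a : CoeffSpace N K) (I : Fin N → ℕ) : ℝ :=
  if h : ∃ k : ℕ, (k : ℕ∞) ≤ K ∧ ∑ i, I i = 2 * k then (a ⟨I, h⟩ : ℝ) else 0

/-- The space `ℬ` of symmetric matrices with strictly positive entries and all eigenvalues
strictly between `0` and `1`. -/
def matrixSpace (N : ℕ) : Set (Matrix (Fin N) (Fin N) ℝ) :=
  {B | (∀ i j, 0 < B i j) ∧ B.IsHermitian ∧ spectrum ℝ B ⊆ Set.Ioo 0 1}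

theorem matrixSpace_isHermitian {N : ℕ} (B : matrixSpace N) :
    (B : Matrix (Fin N) (Fin N) ℝ).IsHermitian := B.2.2.1

/-- The smallest entry of `B`. -/
def bmin {N : ℕ} (B : matrixSpace N) : ℝ :=
  ⨅ p : Fin N × Fin N, (B : Matrix (Fin N) (Fin N) ℝ) p.1 p.2

/-- `d = ∏_j √(1 - λ_j²)` over the eigenvalues `λ_j` of `B`, with multiplicity. -/
def gbsD {N : ℕ} (B : matrixSpace N) : ℝ :=
  ∏ j, √(1 - (matrixSpace_isHermitian B).eigenvalues j ^ 2)

/-- `μ_Haf = ∑_I a_I Haf(B_I)`. -/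
def muHaf {N : ℕ} {K : ℕ∞} (B : matrixSpace N) (a : CoeffSpace N K) : ℝ :=
  ∑' I : Fin N → ℕ, coeff a I * hafB (B : Matrix (Fin N) (Fin N) ℝ) I

/-- `Q^{GBS-P} = (1/d) ∑_{I,J} a_I a_J J! Haf(B_I) / Haf(B_J)`. -/
def qGBSP {N : ℕ} {K : ℕ∞} (B : matrixSpace N) (a : CoeffSpace N K) : ℝ :=
  1 / gbsD B * ∑' p : (Fin N → ℕ) × (Fin N → ℕ),
    coeff a p.1 * coeff a p.2 * mfact p.2 *
      (hafB (B : Matrix (Fin N) (Fin N) ℝ) p.1 / hafB (B : Matrix (Fin N) (Fin N) ℝ) p.2)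

/-- `Q^{MC} = ∑_{I,J} a_I a_J Haf(B_{I+J})`. -/
def qMC {N : ℕ} {K : ℕ∞} (B : matrixSpace N) (a : CoeffSpace N K) : ℝ :=
  ∑' p : (Fin N → ℕ) × (Fin N → ℕ),
    coeff a p.1 * coeff a p.2 * hafB (B : Matrix (Fin N) (Fin N) ℝ) (p.1 + p.2)

/-- The guaranteed sample size of the GBS-P estimator. -/
def nGBSP {N : ℕ} {K : ℕ∞} (ε δ : ℝ) (B : matrixSpace N) (a : CoeffSpace N K) : ℝ :=
  (qGBSP B a - muHaf B a ^ 2) / (δ * ε ^ 2 * muHaf B a ^ 2)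

/-- The guaranteed sample size of the plain Monte Carlo estimator. -/
def nMC {N : ℕ} {K : ℕ∞} (ε δ : ℝ) (B : matrixSpace N) (a : CoeffSpace N K) : ℝ :=
  (qMC B a - muHaf B a ^ 2) / (δ * ε ^ 2 * muHaf B a ^ 2)

/-- The problem space `𝒫`: pairs `(B, a)` with `μ_Haf ≠ 0` for which `μ_Haf`, `Q^{GBS-P}` and
`Q^{MC}` are finite. -/
def problemSpace (N : ℕ) (K : ℕ∞) : Set (matrixSpace N × CoeffSpace N K) :=
  {x | (Summable fun I : Fin N → ℕ =>
          coeff x.2 I * hafB (x.1 : Matrix (Fin N) (Fin N) ℝ) I) ∧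
       muHaf x.1 x.2 ≠ 0 ∧
       (Summable fun I : Fin N → ℕ =>
          coeff x.2 I * mfact I / hafB (x.1 : Matrix (Fin N) (Fin N) ℝ) I) ∧
       (Summable fun p : (Fin N → ℕ) × (Fin N → ℕ) =>
          coeff x.2 p.1 * coeff x.2 p.2 *
            hafB (x.1 : Matrix (Fin N) (Fin N) ℝ) (p.1 + p.2))}

/-- For `k ≥ 1`: the integer `s_k ≥ 0` in `2k = N s_k + r_k` with `1 ≤ r_k ≤ N`. -/
def sNum (N k : ℕ) : ℕ := (2 * k - 1) / N

/-- For `k ≥ 1`: the integer `1 ≤ r_k ≤ N` in `2k = N s_k + r_k`. -/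
def rNum (N k : ℕ) : ℕ := 2 * k - N * sNum N k

theorem sNum_rNum_spec {N k : ℕ} (hN : 1 ≤ N) (hk : 1 ≤ k) :
    2 * k = N * sNum N k + rNum N k ∧ 1 ≤ rNum N k ∧ rNum N k ≤ N := by
  have h1 := Nat.div_add_mod (2 * k - 1) N
  have h2 := Nat.mod_lt (2 * k - 1) hN
  unfold rNum sNum
  omega

/-- `m_k = (s_k!)^N (s_k + 1)^{r_k}`. -/
def mNum (N k : ℕ) : ℝ := (Nat.factorial (sNum N k) : ℝ) ^ N * ((sNum N k : ℝ) + 1) ^ rNum N k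

open Classical in
/-- `s_K`, with `s_∞ = ∞`. -/
def sENat (N : ℕ) (K : ℕ∞) : ℕ∞ := if K = ⊤ then ⊤ else (sNum N K.toNat : ℕ∞)

open Classical in
/-- The (truncated) polylogarithm `Li_{s,K}(z) = ∑_{1 ≤ k ≤ K} z^k / k^s`. -/
def polylog (s : ℝ) (K : ℕ∞) (z : ℝ) : ℝ :=
  ∑' k : ℕ, if 1 ≤ k ∧ (k : ℕ∞) ≤ K then z ^ k / (k : ℝ) ^ s else 0

/-- `h_{q,n}(z) = ∑_{k=1}^n k^q z^{2k} / (2k)!`. -/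
def hFun (q : ℝ) (n : ℕ) (z : ℝ) : ℝ :=
  ∑ k ∈ Finset.Icc 1 n, (k : ℝ) ^ q / (Nat.factorial (2 * k) : ℝ) * z ^ (2 * k)

/-- The function `G_{q,K,N}`; for `K = ∞` it is meant for `|z| < N` only. -/
def gFun (q : ℝ) (K : ℕ∞) (N : ℕ) (z : ℝ) : ℝ :=
  hFun q (N / 2) z +
    (2 : ℝ) ^ (((N : ℝ) - 1) / 2 - min q 0) * Real.pi ^ (((N : ℝ) - 1) / 2) *
      (N : ℝ) ^ (q - 1 / 2) * Real.exp ((N : ℝ) / 12) *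
      polylog 0 (N : ℕ∞) (2 * z / N) *
      polylog (1 / 2 - (N : ℝ) / 2 - q) (sENat N K) (z ^ N / (N : ℝ) ^ N)

open Classical in
/-- The function `R_{q,K}`; for `K = ∞` it is meant for `|z| < 1` only. -/
def rFun (q : ℝ) (K : ℕ∞) (z : ℝ) : ℝ :=
  if 0 ≤ q then (2 : ℝ) ^ (-q) * (1 / (2 * √Real.pi)) * polylog (1 / 2 - q) K z
  else 1 / (2 * √Real.pi) * polylog (1 / 2 - 2 * q) K z

/-- The subset `ℬ''_{α,β}` of `ℬ`, with its constants explicit. The first clause says that, for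
`K = ∞`, the functions `G` and `R` are evaluated inside their domains. -/
def uniformSpace (N : ℕ) (K : ℕ∞) (ζ p γα γβ qα qβ CG CD CR : ℝ) : Set (matrixSpace N) :=
  {B | (K = ⊤ → √(2 * γβ * (bmin B)⁻¹) < (N : ℝ) ∧ 4 * γα * bmin B < 1) ∧
       gFun qβ K N (√(2 * γβ * (bmin B)⁻¹)) < CG * (N : ℝ) ^ 3 ∧
       1 / (2 * √Real.pi) * (ζ * (N : ℝ) ^ 2) ^ (2 * qα - 1 / 2) * CR ^ (ζ * (N : ℝ) ^ 2) <
         rFun qα K (4 * γα * bmin B) ∧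
       1 / gbsD B < CD * (N : ℝ) ^ p}

/-- The growth conditions on the coefficients: for all `1 ≤ k ≤ K`,
`k^{q_α} γ_α^k / k! ≤ ∑_{|I| = 2k} a_I ≤ k^{q_β} γ_β^k / k!` and
`∑_{|I| = 2k} a_I I! ≤ (k^{q_β} γ_β^k / k!) m_k`. -/
def CoeffBounds {N : ℕ} {K : ℕ∞} (γα γβ qα qβ : ℝ) (a : CoeffSpace N K) : Prop :=
  ∀ k : ℕ, 1 ≤ k → (k : ℕ∞) ≤ K →
    (k : ℝ) ^ qα * γα ^ k / (Nat.factorial k : ℝ) ≤ ∑ I ∈ level N k, coeff a I ∧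
    ∑ I ∈ level N k, coeff a I ≤ (k : ℝ) ^ qβ * γβ ^ k / (Nat.factorial k : ℝ) ∧
    ∑ I ∈ level N k, coeff a I * mfact I ≤
      (k : ℝ) ^ qβ * γβ ^ k / (Nat.factorial k : ℝ) * mNum N k

/-- `K ≥ ζ N²`, for `K` a natural number or `∞`. -/
def LargeDegree (ζ : ℝ) (N : ℕ) (K : ℕ∞) : Prop := K = ⊤ ∨ ζ * (N : ℝ) ^ 2 ≤ (K.toNat : ℝ)

/-- `C^{ζN²}` dominates `(ζN²)^{2 q_α - 1/2} C^{ζN²}` as `N → ∞` (for one, equivalently every,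
`C > 1`): the first factor is `exp(o(N²))`. -/
def Dominates (ζ : ℝ) (qα : ℕ → ℝ) : Prop :=
  Filter.Tendsto
    (fun N : ℕ => (2 * qα N - 1 / 2) * Real.log (ζ * (N : ℝ) ^ 2) / (N : ℝ) ^ 2)
    Filter.atTop (𝓝 0)

end

end GBS

open GBS

/-! ### Hafnians read along words, and their behaviour under permutation and orthogonal change of
basis. -/

namespace GBS

open Finset Equiv

/-! Both sample sizes have the form `(Q/μ² - 1)/(ε²δ)`, and everything reduces to two bounds on
`Haf(B_I)` with `|I| = 2k`. Positive entries give `Haf(B_I) ≥ b_min^k (2k)!/(2^k k!)`, one summand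
per perfect matching (`le_hafB`). In the other direction `Haf(B_I)² ≤ I!/d` (`hafB_sq_le`), which
says that a Gaussian boson sampling probability is at most one. For the latter, the squared hafnians
are summed over all words of length `2k`. This sum is invariant under orthogonal change of basis
(`sum_wordHaf_sq`), so `B` may be replaced by its eigenvalues. For a diagonal matrix the sum is
explicit and is dominated by a product of binomial series `∑ C(2m,m) (λ²/4)^m = (1-λ²)^(-1/2)`.

Put `S = ∑ a_I I!/Haf(B_I)`. Then `Q^{GBS-P} = μS/d` (`qGBSP_eq`), and writing `Haf = Haf²/Haf`
gives `μ ≤ S/d` (`muHaf_le`); also `μ ≥ a_0`. Hence `Q^{GBS-P}/μ² ≤ S/(d a_0)` and `Q^{MC}/μ² ≥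
Q^{MC}/(S/d)²`. The lower hafnian bound and Stirling give `S ≤ a_0 + G` (`dual_tsum_le`). Grouping
`Q^{MC}` by total degree produces `∑ 1/(i!j!) = 2^n/n!` and a central binomial coefficient of size
`4^n/√n`, hence a multiple of `R` (`qMC_ge`). This proves (1); (2) follows because a gap between `ρ`
and `C_R` in the exponent `ζN²` absorbs every factor `exp(o(N²))`.

For (3), take matrices near `(0.91/N)·(all ones) + (0.05/N)·1`, with `γ_α = 0.3N`, `γ_β = 0.4N` and
`q_α = q_β = -2N`. So negative an exponent defeats the exponential constants in `G`, yet costs only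
`exp(O(N log N))` in `R`. As `K` is finite, finitely many strict inequalities between continuous
functions cut out the open set. -/

/-- A uniform lower bound on the entries gives a lower bound on the hafnian. -/
theorem le_hafnian {ι : Type} [Fintype ι] [DecidableEq ι] (M : Matrix ι ι ℝ) {b : ℝ} (hb : 0 ≤ b)
    (h : ∀ i j, b ≤ M i j) {k : ℕ} (hk : Fintype.card ι = 2 * k) :
    b ^ k * ((Nat.factorial (2 * k) : ℝ) / (2 ^ k * Nat.factorial k)) ≤ hafnian M := by
  have hm : Fintype.card ι / 2 = k := by omega
  subst hm
  set m := Fintype.card ι / 2 with hm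
  have e : Fin (2 * m) ≃ ι := Fintype.equivOfCardEq (by simp [hk])
  have hcard : Fintype.card (Fin (2 * m) ≃ ι) = Nat.factorial (2 * m) := by
    rw [Fintype.card_equiv e, Fintype.card_fin]
  have hsum : (Nat.factorial (2 * m) : ℝ) * b ^ m ≤ ∑ σ : Fin (2 * m) ≃ ι, ∏ j : Fin m,
      M (σ ⟨2 * j.1, by have := j.2; omega⟩) (σ ⟨2 * j.1 + 1, by have := j.2; omega⟩) := by
    have : ∑ σ : Fin (2 * m) ≃ ι, b ^ m = (Nat.factorial (2 * m) : ℝ) * b ^ m := by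
      rw [Finset.sum_const, Finset.card_univ, hcard, nsmul_eq_mul]
    rw [← this]
    refine Finset.sum_le_sum fun σ _ => ?_
    calc b ^ m = ∏ _j : Fin m, b := by simp
      _ ≤ _ := Finset.prod_le_prod (fun _ _ => hb) fun j _ => h _ _
  unfold hafnian
  calc _ = (1 / ((Nat.factorial m : ℝ) * 2 ^ m)) * ((Nat.factorial (2 * m) : ℝ) * b ^ m) := by
        field_simp
    _ ≤ _ := mul_le_mul_of_nonneg_left hsum (by positivity)

/-- The number of occurrences of each letter in a word. -/
def content {α ι : Type} [Fintype α] [DecidableEq ι] (w : α → ι) (i : ι) : ℕ :=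
  Fintype.card {a // w a = i}

set_option linter.unusedSectionVars false

section words

variable {α ι : Type} [Fintype α] [DecidableEq α] [Fintype ι] [DecidableEq ι]

theorem content_comp_perm (w : α → ι) (σ : Perm α) : content (w ∘ σ) = content w := by
  ext i
  exact Fintype.card_congr (σ.subtypeEquiv fun a => by simp)

theorem exists_perm_of_content_eq {w v : α → ι} (h : content v = content w) :
    ∃ σ : Perm α, w ∘ σ = v := by
  have hc : ∀ i, Nonempty ({a // v a = i} ≃ {a // w a = i}) := fun i =>
    ⟨Fintype.equivOfCardEq (congrFun h i)⟩
  exact ⟨Equiv.ofFiberEquiv fun i => (hc i).some, funext fun a =>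
    Equiv.ofFiberEquiv_map (fun i => (hc i).some) a⟩

/-- The permutations carrying `w` to `v` form a coset of the stabilizer of `w`, and the stabilizer
permutes each fibre of `w` independently. -/
theorem card_perm_comp_eq {w v : α → ι} (h : content v = content w) :
    #{σ : Perm α | w ∘ σ = v} = ∏ i, Nat.factorial (content w i) := by
  obtain ⟨τ, rfl⟩ := exists_perm_of_content_eq h
  unfold content
  rw [← DomMulAct.stabilizer_card w, Fintype.card_subtype]
  refine Finset.card_bij (fun σ _ => σ * τ⁻¹) ?_ ?_ ?_
  · intro σ hσ
    simp only [Finset.mem_filter, Finset.mem_univ, true_and] at hσ ⊢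
    ext a
    have := congrFun hσ (τ⁻¹ a)
    simpa using this
  · intro a _ b _ hab
    simpa using hab
  · intro σ hσ
    simp only [Finset.mem_filter, Finset.mem_univ, true_and] at hσ ⊢
    refine ⟨σ * τ, ?_, by simp⟩
    ext a
    exact congrFun hσ (τ a)

/-- Orbit counting: as `σ` varies, `w ∘ σ` visits each rearrangement of `w` equally often. This is
the passage between permutation sums, which define hafnians, and word sums, which can be
diagonalised. -/
theorem sum_perm_comp (w : α → ι) (F : (α → ι) → ℝ) :
    ∑ σ : Perm α, F (w ∘ σ) =
      (∏ i, (Nat.factorial (content w i) : ℝ)) * ∑ v with content v = content w, F v := by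
  have h1 : ∑ σ : Perm α, F (w ∘ σ) =
      ∑ v with content v = content w, ∑ σ ∈ ({σ : Perm α | w ∘ ⇑σ = v} : Finset (Perm α)), F (w ∘ ⇑σ) := by
    rw [Finset.sum_fiberwise_of_maps_to (g := fun σ : Perm α => w ∘ ⇑σ)]
    intro σ _
    simp [content_comp_perm]
  rw [h1, Finset.mul_sum]
  refine Finset.sum_congr rfl fun v hv => ?_
  have hv : content v = content w := by simpa using hv
  rw [Finset.sum_congr rfl (g := fun _ => F v) (fun σ hσ => by rw [(Finset.mem_filter.mp hσ).2])]
  rw [Finset.sum_const, card_perm_comp_eq hv, nsmul_eq_mul]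
  push_cast
  rfl

theorem content_le_card (w : α → ι) (i : ι) : content w i ≤ Fintype.card α :=
  Fintype.card_subtype_le _

theorem prod_comp_eq_prod_pow_content (w : α → ι) (f : ι → ℝ) :
    ∏ a, f (w a) = ∏ i, f i ^ content w i := by
  rw [← Finset.prod_fiberwise Finset.univ w]
  refine Finset.prod_congr rfl fun i _ => ?_
  rw [Finset.prod_congr rfl (g := fun _ => f i) (fun a ha => by rw [(Finset.mem_filter.mp ha).2])]
  rw [Finset.prod_const]
  unfold content
  rw [Fintype.card_subtype]

/-- Sums of products over words, bounded by the multinomial formula. -/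
theorem sum_prod_content_le (φ : ι → ℕ → ℝ) (hφ : ∀ i m, 0 ≤ φ i m) :
    ∑ u : α → ι, ∏ i, φ i (content u i) ≤
      (Nat.factorial (Fintype.card α) : ℝ) *
        ∏ i, ∑ m ∈ range (Fintype.card α + 1), φ i m / (Nat.factorial m : ℝ) := by
  rw [Finset.prod_univ_sum, Finset.mul_sum]
  rw [← Finset.sum_fiberwise_of_maps_to (s := univ)
    (t := Fintype.piFinset fun _ : ι => range (Fintype.card α + 1))
    (g := content) (by
      intro u _
      simp only [Fintype.mem_piFinset, Finset.mem_range]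
      intro i
      exact Nat.lt_succ_of_le (content_le_card u i))]
  refine Finset.sum_le_sum fun m _ => ?_
  rw [Finset.sum_congr rfl (g := fun _ => ∏ i, φ i (m i))
    (fun u hu => by rw [(Finset.mem_filter.mp hu).2])]
  rw [Finset.sum_const, nsmul_eq_mul, Finset.prod_div_distrib]
  have hn : 0 ≤ ∏ i, φ i (m i) := Finset.prod_nonneg fun i _ => hφ i _
  have hp : (0:ℝ) < ∏ i, (Nat.factorial (m i) : ℝ) :=
    Finset.prod_pos fun i _ => by positivity
  rw [← mul_div_assoc, le_div_iff₀ hp]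
  -- Equality holds when `m` is the content of some word. The box of all `m` also contains vectors
  -- of the wrong total degree, which no word realises, so only an inequality survives.
  have key : (#{u : α → ι | content u = m} : ℝ) * ∏ i, (Nat.factorial (m i) : ℝ) ≤
      (Nat.factorial (Fintype.card α) : ℝ) := by
    by_cases hne : ∃ u0 : α → ι, content u0 = m
    · obtain ⟨u0, rfl⟩ := hne
      have := sum_perm_comp u0 (fun _ => (1:ℝ))
      simp only [Finset.sum_const, Finset.card_univ, Fintype.card_perm, nsmul_eq_mul,
        mul_one] at this
      rw [this, mul_comm]
    · have : ({u : α → ι | content u = m} : Finset _) = ∅ := by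
        ext u; simp; intro h; exact hne ⟨u, h⟩
      rw [this]; simp
  calc _ = ((#{u : α → ι | content u = m} : ℝ) * ∏ i, (Nat.factorial (m i) : ℝ)) *
        ∏ i, φ i (m i) := by ring
    _ ≤ _ := mul_le_mul_of_nonneg_right key hn

end words

/-- The hafnian of the matrix read along a word of even length. -/
noncomputable def wordHaf {ι : Type} (k : ℕ) (B : Matrix ι ι ℝ) (w : Fin k × Fin 2 → ι) : ℝ :=
  (1 / ((Nat.factorial k : ℝ) * 2 ^ k)) *
    ∑ σ : Perm (Fin k × Fin 2), ∏ j, B (w (σ (j, 0))) (w (σ (j, 1)))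

/-- The equivalence enumerating pairs consecutively. -/
def pairEquiv (m : ℕ) : Fin m × Fin 2 ≃ Fin (2 * m) :=
  finProdFinEquiv.trans (finCongr (mul_comm m 2))

theorem hafnian_eq_wordHaf {ι κ : Type} [Fintype ι] [DecidableEq ι] (B : Matrix κ κ ℝ)
    (w : ι → κ) {k : ℕ} (e : Fin k × Fin 2 ≃ ι) :
    hafnian (B.submatrix w w) = wordHaf k B (w ∘ e) := by
  have hk : Fintype.card ι / 2 = k := by
    rw [← Fintype.card_congr e]; simp
  subst hk
  unfold hafnian wordHaf
  congr 1
  refine Fintype.sum_equiv (Equiv.equivCongr (pairEquiv _).symm e.symm) _ _ fun σ => ?_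
  refine Finset.prod_congr rfl fun j _ => ?_
  simp only [Matrix.submatrix_apply, Function.comp, Equiv.equivCongr_apply_apply,
    Equiv.symm_symm, Equiv.apply_symm_apply]
  congr 3
  · apply Fin.ext; simp [pairEquiv]
  · apply Fin.ext; simp [pairEquiv]; ring

section wordHaf

variable {ι : Type} [Fintype ι] [DecidableEq ι] {k : ℕ}

theorem wordHaf_comp_perm (B : Matrix ι ι ℝ) (w : Fin k × Fin 2 → ι)
    (τ : Perm (Fin k × Fin 2)) : wordHaf k B (w ∘ τ) = wordHaf k B w := by
  unfold wordHaf
  congr 1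
  exact Fintype.sum_equiv (Equiv.mulLeft τ) _ _ fun σ => rfl

/-- The hafnian takes the same value on all rearrangements of `w`, so averaging its square over
permutations gives a sub-sum of the sum over all words. -/
theorem wordHaf_sq_le (B : Matrix ι ι ℝ) (w : Fin k × Fin 2 → ι) :
    (Nat.factorial (2 * k) : ℝ) * wordHaf k B w ^ 2 ≤
      (∏ i, (Nat.factorial (content w i) : ℝ)) * ∑ v, wordHaf k B v ^ 2 := by
  have h := sum_perm_comp w (fun v => wordHaf k B v ^ 2)
  simp only [wordHaf_comp_perm, Finset.sum_const, Finset.card_univ, Fintype.card_perm,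
    nsmul_eq_mul, Fintype.card_prod, Fintype.card_fin] at h
  rw [mul_comm 2 k, h]
  refine mul_le_mul_of_nonneg_left ?_ (by positivity)
  exact Finset.sum_le_sum_of_subset_of_nonneg (Finset.filter_subset _ _)
    fun _ _ _ => sq_nonneg _

theorem prod_pair (f : Fin k × Fin 2 → ℝ) : ∏ p, f p = ∏ j, f (j, 0) * f (j, 1) := by
  rw [Fintype.prod_prod_type]
  simp [Fin.prod_univ_two]

theorem prod_matrix_expand {B O : Matrix ι ι ℝ} {Λ : Matrix ι ι ℝ}
    (hB : ∀ a b, B a b = ∑ c, ∑ c', O a c * O b c' * Λ c c') (x : Fin k × Fin 2 → ι) :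
    ∏ j, B (x (j, 0)) (x (j, 1)) =
      ∑ v : Fin k × Fin 2 → ι, (∏ p, O (x p) (v p)) * ∏ j, Λ (v (j, 0)) (v (j, 1)) := by
  have h1 : ∀ j : Fin k, B (x (j, 0)) (x (j, 1)) =
      ∑ g : Fin 2 → ι, O (x (j, 0)) (g 0) * O (x (j, 1)) (g 1) * Λ (g 0) (g 1) := by
    intro j
    rw [hB, ← Fintype.sum_prod_type']
    exact Fintype.sum_equiv (finTwoArrowEquiv ι).symm _ _ fun p => by simp
  rw [Finset.prod_congr rfl fun j _ => h1 j, Finset.prod_univ_sum, Fintype.piFinset_univ]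
  refine Fintype.sum_equiv (Equiv.curry (Fin k) (Fin 2) ι).symm _ _ fun g => ?_
  rw [prod_pair, ← Finset.prod_mul_distrib]
  rfl

theorem wordHaf_expand {B O : Matrix ι ι ℝ} {Λ : Matrix ι ι ℝ}
    (hB : ∀ a b, B a b = ∑ c, ∑ c', O a c * O b c' * Λ c c') (w : Fin k × Fin 2 → ι) :
    wordHaf k B w = ∑ v : Fin k × Fin 2 → ι, (∏ p, O (w p) (v p)) * wordHaf k Λ v := by
  unfold wordHaf
  rw [Finset.sum_congr rfl fun v _ => mul_left_comm _ _ _, ← Finset.mul_sum]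
  congr 1
  simp_rw [Finset.mul_sum]
  rw [Finset.sum_comm]
  refine Finset.sum_congr rfl fun σ _ => ?_
  rw [prod_matrix_expand hB (fun p => w (σ p))]
  -- Substituting `v ∘ σ⁻¹` for `v` moves `σ` from the factors `O` to the factors `Λ`, where it
  -- rebuilds the hafnian of `Λ`.
  refine Fintype.sum_equiv (Equiv.arrowCongr σ (Equiv.refl ι)) _ _ fun v => ?_
  congr 1
  · simpa [Equiv.arrowCongr] using Equiv.prod_comp σ (fun p => O (w p) (v (σ.symm p)))
  · simp [Equiv.arrowCongr]

/-- The sum of squares of the hafnians over all words is invariant under orthogonal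
transformations. -/
theorem sum_wordHaf_sq {B O : Matrix ι ι ℝ} {Λ : Matrix ι ι ℝ}
    (hB : ∀ a b, B a b = ∑ c, ∑ c', O a c * O b c' * Λ c c')
    (hO : ∀ c c', ∑ a, O a c * O a c' = if c = c' then 1 else 0) :
    ∑ w, wordHaf k B w ^ 2 = ∑ v, wordHaf k Λ v ^ 2 := by
  -- The `2k`-fold tensor power of `O` again has orthonormal columns: the sum over words factorises
  -- over positions.
  have hO' : ∀ v v' : Fin k × Fin 2 → ι,
      ∑ w : Fin k × Fin 2 → ι, (∏ p, O (w p) (v p)) * (∏ p, O (w p) (v' p)) =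
        if v = v' then 1 else 0 := by
    intro v v'
    have h := Finset.prod_univ_sum (κ := fun _ : Fin k × Fin 2 => ι)
      (t := fun _ => (univ : Finset ι)) (fun p a => O a (v p) * O a (v' p))
    rw [Fintype.piFinset_univ] at h
    simp_rw [← Finset.prod_mul_distrib]
    rw [← h]
    simp_rw [hO]
    rw [Finset.prod_ite_zero]
    simp [funext_iff]
  simp_rw [sq, wordHaf_expand hB, Finset.sum_mul_sum]
  rw [Finset.sum_comm]
  refine Finset.sum_congr rfl fun v _ => ?_
  rw [Finset.sum_comm]
  have : ∀ v' : Fin k × Fin 2 → ι,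
      ∑ w : Fin k × Fin 2 → ι, (∏ p, O (w p) (v p)) * wordHaf k Λ v *
        ((∏ p, O (w p) (v' p)) * wordHaf k Λ v') =
      (if v = v' then 1 else 0) * (wordHaf k Λ v * wordHaf k Λ v') := by
    intro v'
    rw [← hO', Finset.sum_mul]
    exact Finset.sum_congr rfl fun w _ => by ring
  simp_rw [this]
  simp

end wordHaf

end GBS

/-! ### The diagonal case, and upper and lower bounds on `Haf(B_I)`. -/

namespace GBS

open Finset Equiv

/-- The function `(1-x)^(-1/2)` solves `(1-x)P' = P/2`. For a truncated series the two sides cancel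
term by term, except for a defect at the top degree; its sign is what matters. -/
theorem hasDerivAt_centralBinom_sum (k : ℕ) (x : ℝ) :
    ∃ D : ℝ, HasDerivAt (fun y : ℝ => ∑ m ∈ range (k + 1), (m.centralBinom : ℝ) / 4 ^ m * y ^ m)
      D x ∧ (1 - x) * D - (∑ m ∈ range (k + 1), (m.centralBinom : ℝ) / 4 ^ m * x ^ m) / 2 =
        -((k + 1 / 2) * ((k.centralBinom : ℝ) / 4 ^ k * x ^ k)) := by
  induction k with
  | zero =>
    refine ⟨0, ?_, by norm_num⟩
    simpa using hasDerivAt_const x (1:ℝ)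
  | succ k ih =>
    obtain ⟨D, hD, h⟩ := ih
    refine ⟨D + ((k + 1).centralBinom : ℝ) / 4 ^ (k + 1) * (((k + 1 : ℕ) : ℝ) * x ^ k), ?_, ?_⟩
    · simp_rw [Finset.sum_range_succ _ (k + 1)]
      exact hD.add ((hasDerivAt_pow (k + 1) x).const_mul _)
    · rw [Finset.sum_range_succ _ (k + 1)]
      have hc : ((k:ℝ) + 1) * ((k + 1).centralBinom : ℝ) = 2 * (2 * k + 1) * k.centralBinom := by
        exact_mod_cast Nat.succ_mul_centralBinom_succ k
      have hc' : ((k:ℝ) + 1) * (((k + 1).centralBinom : ℝ) / 4 ^ (k + 1)) =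
          (k + 1 / 2) * ((k.centralBinom : ℝ) / 4 ^ k) := by
        rw [pow_succ]
        field_simp
        linarith
      push_cast
      linear_combination h + x ^ k * hc'

/-- Partial sums of the binomial series of `(1 - x)^(-1/2)` are bounded by its value. -/
theorem centralBinom_sum_le (k : ℕ) {x : ℝ} (h0 : 0 ≤ x) (h1 : x < 1) :
    ∑ m ∈ range (k + 1), (m.centralBinom : ℝ) / 4 ^ m * x ^ m ≤ 1 / √(1 - x) := by
  set P : ℝ → ℝ := fun y => ∑ m ∈ range (k + 1), (m.centralBinom : ℝ) / 4 ^ m * y ^ m with hP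
  have hP0 : ∀ y, 0 ≤ y → 0 ≤ P y := fun y hy => Finset.sum_nonneg fun m _ => by positivity
  -- The derivative of `P²(1-y)` is `2P((1-y)P' - P/2)`, nonpositive by the defect formula.
  -- Comparison with the value `1` at `0` then gives the claim without summing the series.
  have hanti : AntitoneOn (fun y => P y ^ 2 * (1 - y)) (Set.Icc 0 1) := by
    choose D hD hD' using hasDerivAt_centralBinom_sum k
    have hd : ∀ y, HasDerivAt (fun y => P y ^ 2 * (1 - y))
        (2 * P y * ((1 - y) * D y - P y / 2)) y := by
      intro y
      refine (((hD y).fun_pow 2).fun_mul ((hasDerivAt_const y (1:ℝ)).fun_sub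
        (hasDerivAt_id' y))).congr_deriv ?_
      push_cast
      ring
    refine antitoneOn_of_deriv_nonpos (convex_Icc 0 1)
      (fun y _ => (hd y).continuousAt.continuousWithinAt)
      (fun y _ => (hd y).differentiableAt.differentiableWithinAt) fun y hy => ?_
    rw [interior_Icc] at hy
    rw [(hd y).deriv]
    have := hD' y
    refine mul_nonpos_of_nonneg_of_nonpos (mul_nonneg zero_le_two (hP0 y hy.1.le)) ?_
    rw [hP, this]
    have : 0 ≤ y := hy.1.le
    rw [neg_nonpos]
    positivity
  have h := hanti (Set.left_mem_Icc.mpr zero_le_one) ⟨h0, h1.le⟩ h0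
  have hz : P 0 = 1 := by
    simp only [hP]
    rw [Finset.sum_range_succ']
    simp
  simp only [hz] at h
  have hs : 0 < √(1 - x) := Real.sqrt_pos.mpr (by linarith)
  rw [le_div_iff₀ hs]
  refine le_of_sq_le_sq ?_ zero_le_one
  rw [mul_pow, Real.sq_sqrt (by linarith)]
  simpa using h

section diag

set_option linter.unusedSectionVars false

variable {ι : Type} [Fintype ι] [DecidableEq ι] {k : ℕ}

/-- The word in which each letter is doubled. -/
def double (u : Fin k → ι) (p : Fin k × Fin 2) : ι := u p.1

theorem content_double (u : Fin k → ι) (i : ι) : content (double u) i = 2 * content u i := by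
  have e : {p : Fin k × Fin 2 // double u p = i} ≃ {j : Fin k // u j = i} × Fin 2 :=
    { toFun := fun p => (⟨p.1.1, p.2⟩, p.1.2)
      invFun := fun q => ⟨(q.1.1, q.2), q.1.2⟩
      left_inv := fun _ => rfl
      right_inv := fun _ => rfl }
  unfold content
  rw [Fintype.card_congr e, Fintype.card_prod, Fintype.card_fin, mul_comm]

/-- A product of entries of a diagonal matrix vanishes unless both letters of every pair agree, so
only doubled words contribute. -/
theorem sum_mul_prod_diagonal (d : ι → ℝ) (g : (Fin k × Fin 2 → ι) → ℝ) :
    ∑ w, g w * ∏ j, Matrix.diagonal d (w (j, 0)) (w (j, 1)) =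
      ∑ u : Fin k → ι, g (double u) * ∏ j, d (u j) := by
  symm
  refine Finset.sum_of_injOn double ?_ (by simp) ?_ ?_
  · intro u _ v _ h
    ext j
    exact congrFun h (j, 0)
  · intro w _ hw
    by_contra hne
    apply hw
    refine ⟨fun j => w (j, 0), by simp, ?_⟩
    ext ⟨j, b⟩
    have hp := right_ne_zero_of_mul hne
    rw [Finset.prod_ne_zero_iff] at hp
    have hj : w (j, 0) = w (j, 1) := by
      by_contra h
      exact hp j (Finset.mem_univ j) (Matrix.diagonal_apply_ne _ h)
    fin_cases b
    · rfl
    · exact hj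
  · intro u _
    simp [double]

/-- Each rearrangement of the doubled word is reached `∏ (2c_i)!` times, where `c` is the content of
`u`. Among them, those contributing are the doublings of rearrangements of `u`; there are `k!/∏
c_i!` of these, all with the same product. -/
theorem wordHaf_diagonal_double (d : ι → ℝ) (u : Fin k → ι) :
    wordHaf k (Matrix.diagonal d) (double u) * ∏ i, (Nat.factorial (content u i) : ℝ) =
      (1 / 2 ^ k) * (∏ i, (Nat.factorial (2 * content u i) : ℝ)) * ∏ j, d (u j) := by
  have h1 := sum_perm_comp (double u)
    (fun w : Fin k × Fin 2 → ι => ∏ j, Matrix.diagonal d (w (j, 0)) (w (j, 1)))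
  have h2 : ∑ v ∈ ({v | content v = content (double u)} : Finset (Fin k × Fin 2 → ι)),
      ∏ j, Matrix.diagonal d (v (j, 0)) (v (j, 1)) =
      ∑ u' ∈ ({u' | content u' = content u} : Finset (Fin k → ι)), ∏ j, d (u' j) := by
    rw [Finset.sum_filter, Finset.sum_filter]
    have := sum_mul_prod_diagonal d
      (fun v : Fin k × Fin 2 → ι => if content v = content (double u) then (1:ℝ) else 0)
    simp only [ite_mul, one_mul, zero_mul] at this
    rw [this]
    refine Finset.sum_congr rfl fun u' _ => ?_
    have : content (double u') = content (double u) ↔ content u' = content u := by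
      simp only [funext_iff, content_double]
      constructor <;> intro h i <;> have := h i <;> omega
    simp only [this]
  have h3 : ∀ u' ∈ ({u' | content u' = content u} : Finset (Fin k → ι)),
      ∏ j, d (u' j) = ∏ j, d (u j) := by
    intro u' hu'
    rw [prod_comp_eq_prod_pow_content, prod_comp_eq_prod_pow_content u,
      (Finset.mem_filter.mp hu').2]
  have h4 := sum_perm_comp u (fun _ => (1:ℝ))
  simp only [Finset.sum_const, Finset.card_univ, Fintype.card_perm, nsmul_eq_mul,
    mul_one, Fintype.card_fin] at h4
  rw [h2, Finset.sum_congr rfl h3, Finset.sum_const, nsmul_eq_mul] at h1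
  simp only [content_double] at h1
  unfold wordHaf
  simp only [Function.comp] at h1
  rw [h1]
  have hk : (Nat.factorial k : ℝ) ≠ 0 := by positivity
  rw [show ∀ a b c e f : ℝ, a * (b * (c * e)) * f = a * (f * c) * b * e by intros; ring, ← h4]
  field_simp

/-- Only one of the two factors in `H²` is expanded into permutations. Since the other is
permutation invariant, all `(2k)!` terms agree after reindexing, and the single matching left over
restricts the sum to doubled words. -/
theorem sum_wordHaf_diagonal_sq (d : ι → ℝ) :
    ∑ w, wordHaf k (Matrix.diagonal d) w ^ 2 =
      (Nat.factorial (2 * k) : ℝ) / Nat.factorial k *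
        ∑ u : Fin k → ι, ∏ i, ((d i ^ 2 / 4) ^ content u i *
          ((Nat.factorial (2 * content u i) : ℝ) / Nat.factorial (content u i))) := by
  set H := wordHaf k (Matrix.diagonal d) with hH
  set F : (Fin k × Fin 2 → ι) → ℝ := fun w => ∏ j, Matrix.diagonal d (w (j, 0)) (w (j, 1)) with hF
  have h1 : ∑ w, H w ^ 2 =
      (1 / ((Nat.factorial k : ℝ) * 2 ^ k)) * ((Nat.factorial (2 * k) : ℝ) * ∑ w, H w * F w) := by
    have : ∀ w, H w ^ 2 = (1 / ((Nat.factorial k : ℝ) * 2 ^ k)) *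
        ∑ σ : Perm (Fin k × Fin 2), H (w ∘ σ) * F (w ∘ σ) := by
      intro w
      simp_rw [hH, wordHaf_comp_perm]
      rw [← Finset.mul_sum, mul_left_comm, sq]
      rfl
    simp_rw [this]
    rw [← Finset.mul_sum, Finset.sum_comm]
    congr 1
    have h : ∀ σ : Perm (Fin k × Fin 2), ∑ w : Fin k × Fin 2 → ι, H (w ∘ σ) * F (w ∘ σ) =
        ∑ w, H w * F w := fun σ =>
      Fintype.sum_equiv (Equiv.arrowCongr σ.symm (Equiv.refl ι)) _ _ fun w => rfl
    simp_rw [h]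
    rw [Finset.sum_const, Finset.card_univ, Fintype.card_perm, nsmul_eq_mul]
    simp [mul_comm]
  rw [h1, hF, sum_mul_prod_diagonal, ← mul_assoc, Finset.mul_sum, Finset.mul_sum]
  refine Finset.sum_congr rfl fun u _ => ?_
  have h2 := wordHaf_diagonal_double d u
  have hp : (∏ i, (Nat.factorial (content u i) : ℝ)) ≠ 0 :=
    Finset.prod_ne_zero_iff.mpr fun i _ => by positivity
  rw [← eq_div_iff hp] at h2
  rw [hH, h2, Finset.prod_mul_distrib, ← prod_comp_eq_prod_pow_content u (fun i => d i ^ 2 / 4),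
    Finset.prod_div_distrib, Finset.prod_div_distrib, Finset.prod_pow]
  have h4 : (4:ℝ) ^ k = 2 ^ k * 2 ^ k := by rw [← mul_pow]; norm_num
  simp only [Finset.prod_const, Finset.card_univ, Fintype.card_fin, h4]
  field_simp

/-- The multinomial bound splits the sum over letters; the factor of letter `i` is a partial sum of
the binomial series of `(1 - d_i²)^(-1/2)`. -/
theorem sum_wordHaf_diagonal_sq_le (d : ι → ℝ) (h0 : ∀ i, 0 ≤ d i) (h1 : ∀ i, d i < 1) :
    ∑ w, wordHaf k (Matrix.diagonal d) w ^ 2 ≤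
      (Nat.factorial (2 * k) : ℝ) * (1 / ∏ i, √(1 - d i ^ 2)) := by
  rw [sum_wordHaf_diagonal_sq]
  have h := sum_prod_content_le (α := Fin k) (fun i m => (d i ^ 2 / 4) ^ m *
    ((Nat.factorial (2 * m) : ℝ) / Nat.factorial m)) (fun i m => by positivity)
  rw [Fintype.card_fin] at h
  have h2 : ∏ i, ∑ m ∈ range (k + 1), (d i ^ 2 / 4) ^ m *
      ((Nat.factorial (2 * m) : ℝ) / Nat.factorial m) / (Nat.factorial m : ℝ) ≤
      1 / ∏ i, √(1 - d i ^ 2) := by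
    rw [one_div, ← Finset.prod_inv_distrib]
    refine Finset.prod_le_prod (fun i _ => Finset.sum_nonneg fun m _ => by positivity)
      fun i _ => ?_
    rw [← one_div]
    refine le_trans (le_of_eq ?_) (centralBinom_sum_le k (sq_nonneg (d i)) ?_)
    · refine Finset.sum_congr rfl fun m _ => ?_
      have hc : (m.centralBinom : ℝ) = Nat.factorial (2 * m) / (Nat.factorial m * Nat.factorial m) := by
        rw [Nat.centralBinom, Nat.cast_choose ℝ (by omega : m ≤ 2 * m)]
        congr 4
        omega
      rw [hc, div_pow]
      field_simp
    · have := h0 i; have := h1 i; nlinarith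
  calc _ ≤ (Nat.factorial (2 * k) : ℝ) / Nat.factorial k * ((Nat.factorial k : ℝ) * _) :=
        mul_le_mul_of_nonneg_left (h.trans (mul_le_mul_of_nonneg_left h2 (by positivity)))
          (by positivity)
    _ = _ := by field_simp

end diag

theorem isHermitian_expand {N : ℕ} {B : Matrix (Fin N) (Fin N) ℝ} (hB : B.IsHermitian) :
    ∃ O : Matrix (Fin N) (Fin N) ℝ,
      (∀ a b, B a b = ∑ c, ∑ c', O a c * O b c' * Matrix.diagonal hB.eigenvalues c c') ∧
      ∀ c c', ∑ a, O a c * O a c' = if c = c' then 1 else 0 := by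
  refine ⟨hB.eigenvectorUnitary, ?_, ?_⟩
  · intro a b
    conv_lhs => rw [hB.spectral_theorem]
    simp [Unitary.conjStarAlgAut_apply, Matrix.mul_apply, Matrix.diagonal_apply,
      Matrix.star_apply]
    exact Finset.sum_congr rfl fun c _ => by ring
  · intro c c'
    have h := Unitary.coe_star_mul_self hB.eigenvectorUnitary
    have := congrFun (congrFun h c) c'
    simpa [Matrix.mul_apply, Matrix.star_apply, Matrix.one_apply] using this

section matrixSpace

variable {N : ℕ}

theorem eigenvalues_mem_Ioo (B : matrixSpace N) (j : Fin N) :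
    (matrixSpace_isHermitian B).eigenvalues j ∈ Set.Ioo (0:ℝ) 1 :=
  B.2.2.2 ((matrixSpace_isHermitian B).eigenvalues_mem_spectrum_real j)

theorem gbsD_pos (B : matrixSpace N) : 0 < gbsD B := by
  refine Finset.prod_pos fun j _ => Real.sqrt_pos.mpr ?_
  obtain ⟨h0, h1⟩ := eigenvalues_mem_Ioo B j
  nlinarith

/-- Every hafnian `Haf(B_I)` is read along a word with content `I`. -/
theorem exists_word {I : Fin N → ℕ} {k : ℕ} (hI : ∑ i, I i = 2 * k) :
    ∃ w : Fin k × Fin 2 → Fin N, content w = I ∧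
      ∀ B : Matrix (Fin N) (Fin N) ℝ, hafB B I = wordHaf k B w := by
  have e : Fin k × Fin 2 ≃ (Σ i : Fin N, Fin (I i)) := Fintype.equivOfCardEq (by
    simp [hI, mul_comm])
  refine ⟨Sigma.fst ∘ e, ?_, fun B => hafnian_eq_wordHaf B _ e⟩
  ext i
  unfold content
  rw [Fintype.card_congr (e.subtypeEquiv (p := fun p => (Sigma.fst ∘ e) p = i)
    (q := fun x => x.1 = i) fun p => Iff.rfl),
    Fintype.card_congr (Equiv.sigmaSubtype i)]
  simp

/-- One word of content `I` is bounded by the sum over all words, which is evaluated in an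
eigenbasis. The factors `(2k)!` on the two sides cancel. -/
theorem hafB_sq_le (B : matrixSpace N) {I : Fin N → ℕ} {k : ℕ} (hI : ∑ i, I i = 2 * k) :
    hafB (B : Matrix (Fin N) (Fin N) ℝ) I ^ 2 ≤ mfact I / gbsD B := by
  obtain ⟨w, rfl, hw⟩ := exists_word hI
  rw [hw]
  obtain ⟨O, hO, hO'⟩ := isHermitian_expand (matrixSpace_isHermitian B)
  have h1 := wordHaf_sq_le (B : Matrix (Fin N) (Fin N) ℝ) w
  rw [sum_wordHaf_sq hO hO'] at h1
  have h2 := h1.trans (mul_le_mul_of_nonneg_left (sum_wordHaf_diagonal_sq_le (k := k) _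
    (fun i => (eigenvalues_mem_Ioo B i).1.le) (fun i => (eigenvalues_mem_Ioo B i).2))
    (by positivity))
  have hf : (0:ℝ) < Nat.factorial (2 * k) := by positivity
  refine le_of_mul_le_mul_left (h2.trans (le_of_eq ?_)) hf
  unfold mfact gbsD
  ring

theorem bmin_le [NeZero N] (B : matrixSpace N) (i j : Fin N) :
    bmin B ≤ (B : Matrix (Fin N) (Fin N) ℝ) i j :=
  ciInf_le (Set.finite_range fun p : Fin N × Fin N =>
    (B : Matrix (Fin N) (Fin N) ℝ) p.1 p.2).bddBelow (i, j)

theorem le_bmin [NeZero N] (B : matrixSpace N) {c : ℝ}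
    (h : ∀ i j, c ≤ (B : Matrix (Fin N) (Fin N) ℝ) i j) : c ≤ bmin B :=
  le_ciInf fun p => h p.1 p.2

theorem bmin_pos [NeZero N] (B : matrixSpace N) : 0 < bmin B := by
  obtain ⟨p, hp⟩ := exists_eq_ciInf_of_finite (f := fun p : Fin N × Fin N =>
    (B : Matrix (Fin N) (Fin N) ℝ) p.1 p.2)
  unfold bmin
  rw [← hp]
  exact B.2.1 _ _

theorem le_hafB [NeZero N] (B : matrixSpace N) {I : Fin N → ℕ} {k : ℕ} (hI : ∑ i, I i = 2 * k) :
    bmin B ^ k * ((Nat.factorial (2 * k) : ℝ) / (2 ^ k * Nat.factorial k)) ≤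
      hafB (B : Matrix (Fin N) (Fin N) ℝ) I :=
  le_hafnian _ (bmin_pos B).le (fun _ _ => bmin_le B _ _) (by simp [hI])

theorem hafB_pos [NeZero N] (B : matrixSpace N) {I : Fin N → ℕ} {k : ℕ} (hI : ∑ i, I i = 2 * k) :
    0 < hafB (B : Matrix (Fin N) (Fin N) ℝ) I :=
  lt_of_lt_of_le (mul_pos (pow_pos (bmin_pos B) _) (by positivity)) (le_hafB B hI)

end matrixSpace

theorem hafB_zero {N : ℕ} (B : Matrix (Fin N) (Fin N) ℝ) : hafB B 0 = 1 := by
  obtain ⟨w, -, hw⟩ := exists_word (N := N) (I := 0) (k := 0) (by simp)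
  rw [hw]
  simp [wordHaf]

end GBS

/-! ### Stirling estimates and the majorant `G`. -/

namespace GBS

open Finset

/-- The Stirling sequence decreases from `e/√2` at `s = 1`, so a single numerical comparison,
`e^(11/12) ≤ √(2π)`, covers all `s`. -/
theorem factorial_le_stirling {s : ℕ} (hs : 1 ≤ s) :
    (Nat.factorial s : ℝ) ≤ √(2 * Real.pi * s) * ((s : ℝ) / Real.exp 1) ^ s * Real.exp (1 / 12) := by
  have h1 : Stirling.stirlingSeq s ≤ Real.exp 1 / √2 := by
    obtain ⟨n, rfl⟩ : ∃ n, s = n + 1 := ⟨s - 1, by omega⟩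
    have := Stirling.stirlingSeq'_antitone (Nat.zero_le n)
    simpa [Function.comp, Stirling.stirlingSeq_one] using this
  have h2 : Real.exp 1 / √2 ≤ √Real.pi * Real.exp (1 / 12) := by
    rw [div_le_iff₀ (by positivity)]
    have h3 : Real.exp (11 / 12) ≤ √Real.pi * √2 := by
      rw [← Real.sqrt_mul Real.pi_pos.le]
      apply Real.le_sqrt_of_sq_le
      -- Sixth powers of the squared inequality turn it into `e^11 ≤ (2π)^6`, where decimal bounds
      -- suffice.
      refine le_of_pow_le_pow_left₀ (n := 6) (by norm_num) (by positivity) ?_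
      rw [← pow_mul, ← Real.exp_nat_mul]
      have he : Real.exp 1 ^ 11 ≤ 2.7182818286 ^ 11 :=
        pow_le_pow_left₀ (Real.exp_pos _).le Real.exp_one_lt_d9.le 11
      have hp : (3.1415 * 2 : ℝ) ^ 6 ≤ (Real.pi * 2) ^ 6 :=
        pow_le_pow_left₀ (by norm_num) (by linarith [Real.pi_gt_d4]) 6
      rw [← Real.exp_nat_mul] at he
      norm_num at he hp ⊢
      linarith
    calc Real.exp 1 = Real.exp (11 / 12) * Real.exp (1 / 12) := by
          rw [← Real.exp_add]; norm_num
      _ ≤ (√Real.pi * √2) * Real.exp (1 / 12) := by gcongr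
      _ = _ := by ring
  have h := h1.trans h2
  have hs' : (0:ℝ) < s := by exact_mod_cast hs
  unfold Stirling.stirlingSeq at h
  rw [div_le_iff₀ (by positivity)] at h
  refine h.trans (le_of_eq ?_)
  rw [show (2 * Real.pi * s : ℝ) = Real.pi * (2 * s) by ring, Real.sqrt_mul Real.pi_pos.le]
  ring

/-- Stirling at `x + r` is re-expressed through `x` alone by `1 - t ≤ e^(-t)` with `t = r/(x+r)`.
For `x = Ns` the powers of `s` and `e` then match those of `(s!)^N`. -/
theorem le_factorial_add {x r : ℕ} (hx : 1 ≤ x) :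
    √(2 * Real.pi * x) * ((x : ℝ) ^ (x + r) * Real.exp (-x)) ≤ (Nat.factorial (x + r) : ℝ) := by
  refine le_trans ?_ (Stirling.le_factorial_stirling (x + r))
  have hx' : (0:ℝ) < x := by exact_mod_cast hx
  have hn : (0:ℝ) < (x:ℝ) + r := by positivity
  push_cast
  refine mul_le_mul (Real.sqrt_le_sqrt ?_) ?_ (by positivity) (by positivity)
  · have : (0:ℝ) ≤ r := by positivity
    nlinarith [Real.pi_pos, mul_nonneg Real.pi_pos.le this]
  · have h1 : (x:ℝ) ≤ ((x:ℝ) + r) * Real.exp (-(r / (x + r))) := by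
      have h := Real.add_one_le_exp (-((r:ℝ) / (x + r)))
      calc (x:ℝ) = ((x:ℝ) + r) * (-((r:ℝ) / (x + r)) + 1) := by field_simp; ring
        _ ≤ _ := by gcongr
    have h2 := pow_le_pow_left₀ hx'.le h1 (x + r)
    rw [mul_pow, ← Real.exp_nat_mul] at h2
    rw [div_pow, ← Real.exp_nat_mul]
    have e1 : ((x + r : ℕ):ℝ) * -((r:ℝ) / (x + r)) = -r := by
      push_cast; field_simp
    have e2 : ((x + r : ℕ):ℝ) * 1 = x + r := by push_cast; ring
    rw [e1] at h2
    rw [e2, le_div_iff₀ (Real.exp_pos _), mul_assoc, ← Real.exp_add]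
    calc (x:ℝ) ^ (x + r) * Real.exp (-x + (x + r)) ≤
          (((x:ℝ) + r) ^ (x + r) * Real.exp (-r)) * Real.exp (-x + (x + r)) := by gcongr
      _ = ((x:ℝ) + r) ^ (x + r) * (Real.exp (-r) * Real.exp (-x + (x + r))) := by ring
      _ = _ := by rw [← Real.exp_add]; simp

/-- Stirling from above for `(s!)^N` and from below for `(Ns+r)!`: the factors `s^{Ns} e^{-Ns}`
cancel and leave `N^{-Ns}`, while `(s+1)^r ≤ (2s)^r` leaves `(2/N)^r`. -/
theorem mNum_div_factorial_le {N s r : ℕ} (hN : 1 ≤ N) (hs : 1 ≤ s) :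
    (Nat.factorial s : ℝ) ^ N * ((s : ℝ) + 1) ^ r / (Nat.factorial (N * s + r) : ℝ) ≤
      (2 * Real.pi * s) ^ (((N : ℝ) - 1) / 2) / √N * Real.exp ((N : ℝ) / 12) *
        (2 / (N : ℝ)) ^ r * (1 / (N : ℝ) ^ N) ^ s := by
  have hs' : (1:ℝ) ≤ s := by exact_mod_cast hs
  have hN' : (1:ℝ) ≤ N := by exact_mod_cast hN
  have hs0 : (0:ℝ) < s := by linarith
  have hN0 : (0:ℝ) < N := by linarith
  have hA : (Nat.factorial s : ℝ) ^ N ≤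
      √(2 * Real.pi * s) ^ N * ((s : ℝ) / Real.exp 1) ^ (N * s) * Real.exp ((N : ℝ) / 12) := by
    refine (pow_le_pow_left₀ (by positivity) (factorial_le_stirling hs) N).trans (le_of_eq ?_)
    rw [mul_pow, mul_pow, ← pow_mul, ← Real.exp_nat_mul, mul_comm s N]
    congr 2
    ring
  have hB : ((s : ℝ) + 1) ^ r ≤ (2 * s) ^ r :=
    pow_le_pow_left₀ (by positivity) (by linarith) r
  have hC := le_factorial_add (x := N * s) (r := r) (Nat.mul_pos hN hs)
  have hD : 0 < √(2 * Real.pi * (N * s : ℕ)) * (((N * s : ℕ) : ℝ) ^ (N * s + r) *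
      Real.exp (-((N * s : ℕ) : ℝ))) := by positivity
  refine (div_le_div₀ (by positivity) (mul_le_mul hA hB (by positivity) (by positivity)) hD
    hC).trans (le_of_eq ?_)
  have e1 : (2 * Real.pi * s) ^ (((N : ℝ) - 1) / 2) =
      √(2 * Real.pi * s) ^ N / √(2 * Real.pi * s) := by
    rw [Real.sqrt_eq_rpow, ← Real.rpow_natCast, ← Real.rpow_mul (by positivity),
      ← Real.rpow_sub (by positivity)]
    congr 1
    ring
  have e2 : √(2 * Real.pi * (N * s : ℕ)) = √(2 * Real.pi * s) * √N := by
    rw [← Real.sqrt_mul (by positivity)]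
    congr 1
    push_cast
    ring
  have e3 : ((s : ℝ) / Real.exp 1) ^ (N * s) = (s:ℝ) ^ (N * s) * Real.exp (-((N * s : ℕ) : ℝ)) := by
    rw [div_pow, ← Real.exp_nat_mul, Real.exp_neg, mul_one]
    rfl
  rw [e1, e2, e3]
  push_cast
  rw [mul_pow (N:ℝ) (s:ℝ), pow_add, pow_add, mul_pow, div_pow, div_pow, one_pow, ← pow_mul]
  have h1 : √(2 * Real.pi * s) ≠ 0 := by positivity
  have h2 : √(N:ℝ) ≠ 0 := by positivity
  field_simp

theorem rpow_le_of_half_le {q k x : ℝ} (hx : 0 < x) (h1 : x / 2 ≤ k) (h2 : k ≤ x) :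
    k ^ q ≤ 2 ^ (-min q 0) * x ^ q := by
  have hk : 0 < k := by linarith
  rcases le_total 0 q with hq | hq
  · rw [min_eq_right hq]
    simpa using Real.rpow_le_rpow hk.le h2 hq
  · rw [min_eq_left hq, Real.rpow_neg zero_le_two, ← div_eq_inv_mul,
      ← Real.div_rpow hx.le zero_le_two]
    exact Real.rpow_le_rpow_of_nonpos (by linarith) h1 hq

section polylog

theorem polylog_term_nonneg (s : ℝ) (K : ℕ∞) {z : ℝ} (hz : 0 ≤ z) (k : ℕ) :
    0 ≤ (open Classical in if 1 ≤ k ∧ (k : ℕ∞) ≤ K then z ^ k / (k : ℝ) ^ s else 0) := by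
  split_ifs <;> positivity

theorem summable_polylog (s : ℝ) {K : ℕ∞} {z : ℝ} (hz : 0 ≤ z) (h : K = ⊤ → z < 1) :
    Summable (fun k : ℕ =>
      open Classical in if 1 ≤ k ∧ (k : ℕ∞) ≤ K then z ^ k / (k : ℝ) ^ s else 0) := by
  classical
  by_cases hK : K = ⊤
  · obtain ⟨n, hn⟩ := exists_nat_ge (-s)
    have hsum := summable_pow_mul_geometric_of_norm_lt_one (R := ℝ) n (r := z)
      (by rw [Real.norm_eq_abs, abs_of_nonneg hz]; exact h hK)
    refine Summable.of_nonneg_of_le (polylog_term_nonneg s K hz) (fun k => ?_) hsum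
    split_ifs with hk
    · have hk1 : (1:ℝ) ≤ k := by exact_mod_cast hk.1
      rw [div_eq_mul_inv, ← Real.rpow_neg (by positivity), mul_comm]
      gcongr
      rw [← Real.rpow_natCast]
      exact Real.rpow_le_rpow_of_exponent_le hk1 hn
    · positivity
  · lift K to ℕ using hK
    refine summable_of_ne_finset_zero (s := Finset.range (K + 1)) fun k hk => ?_
    rw [if_neg]
    rintro ⟨-, h⟩
    have : k ≤ K := by exact_mod_cast h
    exact hk (Finset.mem_range.mpr (by omega))

theorem sum_le_polylog (s : ℝ) {K : ℕ∞} {z : ℝ} (hz : 0 ≤ z) (h : K = ⊤ → z < 1) (F : Finset ℕ)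
    (hF : ∀ k ∈ F, 1 ≤ k ∧ (k : ℕ∞) ≤ K) : ∑ k ∈ F, z ^ k / (k : ℝ) ^ s ≤ polylog s K z := by
  classical
  refine le_trans (le_of_eq ?_) ((summable_polylog s hz h).sum_le_tsum F
    fun k _ => polylog_term_nonneg s K hz k)
  exact Finset.sum_congr rfl fun k hk => by rw [if_pos (hF k hk)]

theorem polylog_nonneg (s : ℝ) (K : ℕ∞) {z : ℝ} (hz : 0 ≤ z) : 0 ≤ polylog s K z :=
  tsum_nonneg (polylog_term_nonneg s K hz)

/-- Only finite partial sums matter for upper bounds on the polylogarithm. -/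
theorem polylog_le_of_sum_le (s : ℝ) {K : ℕ∞} {z c : ℝ} (hc : 0 ≤ c) (hz : 0 ≤ z)
    (h : ∀ M : ℕ, (M : ℕ∞) ≤ K → ∑ k ∈ Icc 1 M, z ^ k / (k : ℝ) ^ s ≤ c) :
    polylog s K z ≤ c := by
  classical
  refine Real.tsum_le_of_sum_le (polylog_term_nonneg s K hz) fun F => ?_
  rw [← Finset.sum_filter]
  set F' := F.filter fun k : ℕ => 1 ≤ k ∧ (k : ℕ∞) ≤ K with hF'
  by_cases hne : F'.Nonempty
  · refine le_trans (Finset.sum_le_sum_of_subset_of_nonneg (t := Icc 1 (F'.max' hne)) ?_ ?_)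
      (h _ ((Finset.mem_filter.mp (F'.max'_mem hne)).2.2))
    · intro k hk
      exact Finset.mem_Icc.mpr ⟨(Finset.mem_filter.mp hk).2.1, F'.le_max' k hk⟩
    · intro k _ _
      positivity
  · rw [Finset.not_nonempty_iff_eq_empty.mp hne]
    simpa using hc

end polylog

theorem sNum_eq_zero_iff {N k : ℕ} (hN : 1 ≤ N) (hk : 1 ≤ k) : sNum N k = 0 ↔ 2 * k ≤ N := by
  unfold sNum
  rw [Nat.div_eq_zero_iff]
  omega

theorem mNum_eq_one {N k : ℕ} (hN : 1 ≤ N) (hk : 1 ≤ k) (h : 2 * k ≤ N) : mNum N k = 1 := by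
  unfold mNum
  rw [(sNum_eq_zero_iff hN hk).mpr h]
  simp

theorem term_le_polylog_terms {N k : ℕ} (hN : 1 ≤ N) (hk : 1 ≤ k) (h : N < 2 * k) (q : ℝ) {z : ℝ}
    (hz : 0 ≤ z) :
    (k : ℝ) ^ q * mNum N k / (Nat.factorial (2 * k) : ℝ) * z ^ (2 * k) ≤
      (2 : ℝ) ^ (((N : ℝ) - 1) / 2 - min q 0) * Real.pi ^ (((N : ℝ) - 1) / 2) *
      (N : ℝ) ^ (q - 1 / 2) * Real.exp ((N : ℝ) / 12) *
      ((2 * z / N) ^ rNum N k / (rNum N k : ℝ) ^ (0:ℝ)) *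
      ((z ^ N / (N : ℝ) ^ N) ^ sNum N k / (sNum N k : ℝ) ^ (1 / 2 - (N : ℝ) / 2 - q)) := by
  obtain ⟨h1, h2, h3⟩ := sNum_rNum_spec hN hk
  have hs : 1 ≤ sNum N k := by
    by_contra hs
    have := (sNum_eq_zero_iff hN hk).mp (by omega)
    omega
  unfold mNum
  set s := sNum N k
  set r := rNum N k
  have hs0 : (0:ℝ) < s := by exact_mod_cast hs
  have hN0 : (0:ℝ) < N := by exact_mod_cast hN
  have h1r : (2:ℝ) * k = N * s + r := by exact_mod_cast h1
  have hrN : (r:ℝ) ≤ N := by exact_mod_cast h3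
  have hs1 : (1:ℝ) ≤ s := by exact_mod_cast hs
  have hr0 : (0:ℝ) ≤ r := by positivity
  -- From `2k = Ns + r` with `r ≤ N ≤ Ns`, the index `k` lies between `Ns/2` and `Ns`. The lower end
  -- is used when `q < 0`, whence the power of two in `G`.
  have hkq : (k : ℝ) ^ q ≤ 2 ^ (-min q 0) * (N * s) ^ q :=
    rpow_le_of_half_le (by positivity) (by nlinarith) (by nlinarith)
  rw [h1]
  have hm := mNum_div_factorial_le (r := r) hN hs
  calc _ = (k:ℝ) ^ q * ((Nat.factorial s : ℝ) ^ N * ((s : ℝ) + 1) ^ r /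
          (Nat.factorial (N * s + r) : ℝ)) * z ^ (N * s + r) := by ring
    _ ≤ (2 ^ (-min q 0) * (N * s) ^ q) * ((2 * Real.pi * s) ^ (((N : ℝ) - 1) / 2) / √N *
          Real.exp ((N : ℝ) / 12) * (2 / (N : ℝ)) ^ r * (1 / (N : ℝ) ^ N) ^ s) *
          z ^ (N * s + r) := by
        gcongr
    _ = _ := by
      have e1 : (1:ℝ) / 2 - (N : ℝ) / 2 - q = -(((N:ℝ) - 1) / 2 + q) := by ring
      rw [e1, Real.rpow_neg hs0.le, Real.rpow_add hs0, sub_eq_add_neg _ (min q 0),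
        Real.rpow_add zero_lt_two, Real.rpow_sub hN0, ← Real.sqrt_eq_rpow,
        Real.mul_rpow hN0.le hs0.le, Real.mul_rpow (by positivity) hs0.le,
        Real.mul_rpow zero_le_two Real.pi_pos.le, Real.rpow_zero, pow_add z, pow_mul z,
        mul_div_right_comm (2:ℝ) z, mul_pow _ z]
      simp only [mul_pow, inv_pow, div_eq_mul_inv, inv_inv, inv_one, mul_one, one_mul, mul_inv]
      ring

theorem sNum_le_sENat {N k : ℕ} {K : ℕ∞} (hk : (k : ℕ∞) ≤ K) : (sNum N k : ℕ∞) ≤ sENat N K := by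
  unfold sENat
  split_ifs with h
  · exact le_top
  · lift K to ℕ using h
    have : k ≤ K := by exact_mod_cast hk
    simp only [ENat.toNat_natCast, Nat.cast_le]
    exact Nat.div_le_div_right (by omega)

/-- The function `G` bounds the series it is designed for. -/
theorem sum_le_gFun {N : ℕ} (hN : 1 ≤ N) (q : ℝ) {K : ℕ∞} {z : ℝ} (hz : 0 ≤ z)
    (h : K = ⊤ → z < N) (F : Finset ℕ) (hF : ∀ k ∈ F, 1 ≤ k ∧ (k : ℕ∞) ≤ K) :
    ∑ k ∈ F, (k : ℝ) ^ q * mNum N k / (Nat.factorial (2 * k) : ℝ) * z ^ (2 * k) ≤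
      gFun q K N z := by
  have hN0 : (0:ℝ) < N := by exact_mod_cast hN
  rw [← Finset.sum_filter_add_sum_filter_not F (fun k => 2 * k ≤ N)]
  unfold gFun
  refine add_le_add ?_ ?_
  · unfold hFun
    calc _ = ∑ k ∈ F with 2 * k ≤ N, (k : ℝ) ^ q / (Nat.factorial (2 * k) : ℝ) * z ^ (2 * k) := by
          refine Finset.sum_congr rfl fun k hk => ?_
          rw [Finset.mem_filter] at hk
          rw [mNum_eq_one hN (hF k hk.1).1 hk.2, mul_one]
      _ ≤ _ := by
          refine Finset.sum_le_sum_of_subset_of_nonneg ?_ fun k _ _ => by positivity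
          intro k hk
          rw [Finset.mem_filter] at hk
          have := (hF k hk.1).1
          exact Finset.mem_Icc.mpr ⟨this, by omega⟩
  · set F' := F.filter fun k => ¬ 2 * k ≤ N with hF'
    have hmem : ∀ k ∈ F', 1 ≤ k ∧ (k : ℕ∞) ≤ K ∧ N < 2 * k := by
      intro k hk
      rw [hF', Finset.mem_filter] at hk
      exact ⟨(hF k hk.1).1, (hF k hk.1).2, by omega⟩
    set A : ℕ → ℝ := fun r => (2 * z / N) ^ r / (r : ℝ) ^ (0:ℝ) with hA
    set D : ℕ → ℝ := fun s => (z ^ N / (N : ℝ) ^ N) ^ s / (s : ℝ) ^ (1 / 2 - (N : ℝ) / 2 - q) with hD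
    set c : ℝ := (2 : ℝ) ^ (((N : ℝ) - 1) / 2 - min q 0) * Real.pi ^ (((N : ℝ) - 1) / 2) *
      (N : ℝ) ^ (q - 1 / 2) * Real.exp ((N : ℝ) / 12) with hc
    have hA0 : ∀ r, 0 ≤ A r := fun r => by simp only [hA]; positivity
    have hD0 : ∀ r, 0 ≤ D r := fun r => by simp only [hD]; positivity
    -- Since `k` is recovered from `(r_k, s_k)` and each term splits into a function of `r` times
    -- one of `s`, the sum over `k` is part of a product of two polylogarithms.
    have hinj : ∀ k ∈ F', ∀ l ∈ F', (rNum N k, sNum N k) = (rNum N l, sNum N l) → k = l := by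
      intro k hk l hl hkl
      have h1 := (sNum_rNum_spec hN (hmem k hk).1).1
      have h2 := (sNum_rNum_spec hN (hmem l hl).1).1
      rw [Prod.mk.injEq] at hkl
      rw [hkl.1, hkl.2] at h1
      omega
    have hs1 : ∑ k ∈ F', A (rNum N k) * D (sNum N k) ≤
        (∑ r ∈ F'.image (rNum N), A r) * ∑ s ∈ F'.image (sNum N), D s := by
      rw [Finset.sum_mul_sum, ← Finset.sum_product']
      rw [← Finset.sum_image (f := fun p : ℕ × ℕ => A p.1 * D p.2)
        (g := fun k => (rNum N k, sNum N k)) hinj]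
      refine Finset.sum_le_sum_of_subset_of_nonneg ?_ fun p _ _ => mul_nonneg (hA0 _) (hD0 _)
      intro p hp
      obtain ⟨k, hk, rfl⟩ := Finset.mem_image.mp hp
      exact Finset.mem_product.mpr ⟨Finset.mem_image_of_mem _ hk, Finset.mem_image_of_mem _ hk⟩
    have hP1 : ∑ r ∈ F'.image (rNum N), A r ≤ polylog 0 (N : ℕ∞) (2 * z / N) := by
      refine sum_le_polylog 0 (by positivity) (fun h => by simp at h) _ fun r hr => ?_
      obtain ⟨k, hk, rfl⟩ := Finset.mem_image.mp hr
      have h1 := sNum_rNum_spec hN (hmem k hk).1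
      exact ⟨h1.2.1, by exact_mod_cast h1.2.2⟩
    have hP2 : ∑ s ∈ F'.image (sNum N), D s ≤
        polylog (1 / 2 - (N : ℝ) / 2 - q) (sENat N K) (z ^ N / (N : ℝ) ^ N) := by
      refine sum_le_polylog _ (by positivity) (fun h' => ?_) _ fun s hs => ?_
      · have hK : K = ⊤ := by
          by_contra hK
          unfold sENat at h'
          rw [if_neg hK] at h'
          simp at h'
        rw [← div_pow]
        exact pow_lt_one₀ (by positivity) ((div_lt_one hN0).mpr (h hK)) (by omega)
      · obtain ⟨k, hk, rfl⟩ := Finset.mem_image.mp hs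
        obtain ⟨h1, h2, h3⟩ := hmem k hk
        refine ⟨?_, sNum_le_sENat h2⟩
        by_contra hs
        have := (sNum_eq_zero_iff hN h1).mp (by omega)
        omega
    calc _ ≤ ∑ k ∈ F', c * (A (rNum N k) * D (sNum N k)) := by
          refine Finset.sum_le_sum fun k hk => ?_
          obtain ⟨h1, h2, h3⟩ := hmem k hk
          rw [← mul_assoc]
          exact term_le_polylog_terms hN h1 h3 q hz
      _ = c * ∑ k ∈ F', A (rNum N k) * D (sNum N k) := by rw [Finset.mul_sum]
      _ ≤ c * (polylog 0 (N : ℕ∞) (2 * z / N) *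
          polylog (1 / 2 - (N : ℝ) / 2 - q) (sENat N K) (z ^ N / (N : ℝ) ^ N)) := by
          refine mul_le_mul_of_nonneg_left (hs1.trans ?_) (by positivity)
          exact mul_le_mul hP1 hP2 (Finset.sum_nonneg fun s _ => hD0 s)
            (polylog_nonneg _ _ (by positivity))
      _ = _ := by ring

end GBS

/-! ### Bounds on `μ`, `S` and the two second moments; the explicit sample sizes. -/

namespace GBS

open Finset

section coeff

variable {N : ℕ} {K : ℕ∞}

theorem mem_level {k : ℕ} {I : Fin N → ℕ} : I ∈ level N k ↔ ∑ i, I i = 2 * k := by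
  simp [level]

theorem level_zero : level N 0 = {0} := by
  simp [level]

theorem mfact_pos (I : Fin N → ℕ) : 0 < mfact I := Finset.prod_pos fun i _ => by positivity

theorem coeff_nonneg (a : CoeffSpace N K) (I : Fin N → ℕ) : 0 ≤ coeff a I := by
  unfold coeff
  split_ifs
  · exact NNReal.coe_nonneg _
  · exact le_rfl

theorem exists_of_coeff_ne_zero {a : CoeffSpace N K} {I : Fin N → ℕ} (h : coeff a I ≠ 0) :
    ∃ k : ℕ, (k : ℕ∞) ≤ K ∧ ∑ i, I i = 2 * k := by
  by_contra hn
  exact h (dif_neg hn)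

/-- The support of `f` inside a finite set meets finitely many levels, so partial sums by level
control all finite partial sums, also for `K = ∞`. -/
theorem sum_le_of_level_sums_le {f : (Fin N → ℕ) → ℝ} (hf : ∀ I, 0 ≤ f I)
    (hsupp : ∀ I, f I ≠ 0 → ∃ k : ℕ, (k : ℕ∞) ≤ K ∧ ∑ i, I i = 2 * k) {c : ℝ}
    (h : ∀ M : ℕ, (M : ℕ∞) ≤ K → ∑ k ∈ range (M + 1), ∑ I ∈ level N k, f I ≤ c)
    (s : Finset (Fin N → ℕ)) : ∑ I ∈ s, f I ≤ c := by
  classical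
  have hM : ∃ M : ℕ, (M : ℕ∞) ≤ K ∧ ∀ I ∈ s, f I ≠ 0 → ∃ k ≤ M, ∑ i, I i = 2 * k := by
    by_cases hK : K = ⊤
    · refine ⟨s.sup fun I => ∑ i, I i, by simp [hK], fun I hI hfI => ?_⟩
      obtain ⟨k, -, hk⟩ := hsupp I hfI
      have := Finset.le_sup (f := fun I : Fin N → ℕ => ∑ i, I i) hI
      exact ⟨k, by omega, hk⟩
    · lift K to ℕ using hK
      refine ⟨K, le_rfl, fun I _ hfI => ?_⟩
      obtain ⟨k, hk, hI⟩ := hsupp I hfI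
      exact ⟨k, by exact_mod_cast hk, hI⟩
  obtain ⟨M, hMK, hM⟩ := hM
  refine le_trans ?_ (h M hMK)
  have hdisj : Set.PairwiseDisjoint (↑(range (M + 1))) (fun k => level N k) := by
    intro k _ l _ hkl
    refine Finset.disjoint_left.mpr fun I hk hl => hkl ?_
    have := mem_level.mp hk
    have := mem_level.mp hl
    omega
  rw [← Finset.sum_biUnion hdisj, ← Finset.sum_filter_ne_zero]
  refine Finset.sum_le_sum_of_subset_of_nonneg ?_ fun I _ _ => hf I
  intro I hI
  rw [Finset.mem_filter] at hI
  obtain ⟨k, hk, hIk⟩ := hM I hI.1 hI.2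
  exact Finset.mem_biUnion.mpr ⟨k, Finset.mem_range.mpr (by omega), mem_level.mpr hIk⟩

/-- Lower bounds on a double series from its homogeneous blocks. -/
theorem sum_blocks_le_tsum {f : (Fin N → ℕ) × (Fin N → ℕ) → ℝ} (hf : ∀ p, 0 ≤ f p)
    (hs : Summable f) (M : ℕ) :
    ∑ n ∈ Icc 1 M, ∑ ij ∈ antidiagonal n, ∑ I ∈ level N ij.1, ∑ J ∈ level N ij.2, f (I, J) ≤
      ∑' p, f p := by
  classical
  have h1 : ∀ n, ∑ ij ∈ antidiagonal n, ∑ I ∈ level N ij.1, ∑ J ∈ level N ij.2, f (I, J) =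
      ∑ p ∈ (antidiagonal n).biUnion fun ij => level N ij.1 ×ˢ level N ij.2, f p := by
    intro n
    rw [Finset.sum_biUnion]
    · exact Finset.sum_congr rfl fun ij _ => by rw [Finset.sum_product]
    · intro p _ q _ hpq
      refine Finset.disjoint_left.mpr fun x hx hy => hpq ?_
      rw [Finset.mem_product, mem_level, mem_level] at hx hy
      ext <;> omega
  simp_rw [h1]
  rw [← Finset.sum_biUnion]
  · exact hs.sum_le_tsum _ fun p _ => hf p
  · intro n _ m _ hnm
    refine Finset.disjoint_left.mpr fun x hx hy => hnm ?_
    simp only [Finset.mem_biUnion, Finset.mem_product, mem_level, HasAntidiagonal.mem_antidiagonal] at hx hy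
    obtain ⟨p, hp, hp1, hp2⟩ := hx
    obtain ⟨q, hq, hq1, hq2⟩ := hy
    omega

end coeff

section bounds

variable {N : ℕ} {K : ℕ∞} [NeZero N]

theorem muHaf_term_nonneg (B : matrixSpace N) (a : CoeffSpace N K) (I : Fin N → ℕ) :
    0 ≤ coeff a I * hafB (B : Matrix (Fin N) (Fin N) ℝ) I := by
  by_cases h : coeff a I = 0
  · simp [h]
  · obtain ⟨k, -, hk⟩ := exists_of_coeff_ne_zero h
    exact mul_nonneg (coeff_nonneg a I) (hafB_pos B hk).le

theorem dual_term_nonneg (B : matrixSpace N) (a : CoeffSpace N K) (I : Fin N → ℕ) :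
    0 ≤ coeff a I * mfact I / hafB (B : Matrix (Fin N) (Fin N) ℝ) I := by
  by_cases h : coeff a I = 0
  · simp [h]
  · obtain ⟨k, -, hk⟩ := exists_of_coeff_ne_zero h
    exact div_nonneg (mul_nonneg (coeff_nonneg a I) (mfact_pos I).le) (hafB_pos B hk).le

theorem qMC_term_nonneg (B : matrixSpace N) (a : CoeffSpace N K) (p : (Fin N → ℕ) × (Fin N → ℕ)) :
    0 ≤ coeff a p.1 * coeff a p.2 * hafB (B : Matrix (Fin N) (Fin N) ℝ) (p.1 + p.2) := by
  by_cases h1 : coeff a p.1 = 0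
  · simp [h1]
  by_cases h2 : coeff a p.2 = 0
  · simp [h2]
  obtain ⟨k, -, hk⟩ := exists_of_coeff_ne_zero h1
  obtain ⟨l, -, hl⟩ := exists_of_coeff_ne_zero h2
  refine mul_nonneg (mul_nonneg (coeff_nonneg a _) (coeff_nonneg a _))
    (hafB_pos B (k := k + l) ?_).le
  simp only [Pi.add_apply, Finset.sum_add_distrib]
  omega

theorem coeff_zero_le_muHaf {B : matrixSpace N} {a : CoeffSpace N K}
    (h : Summable fun I : Fin N → ℕ => coeff a I * hafB (B : Matrix (Fin N) (Fin N) ℝ) I) :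
    coeff a 0 ≤ muHaf B a := by
  have := h.le_tsum 0 fun I _ => muHaf_term_nonneg B a I
  rwa [hafB_zero, mul_one] at this

/-- Dividing by the matching count `(2k)!/(2^k k!)` cancels the `k!` of the growth condition and
leaves `(2γ/b_min)^k/(2k)!`; this explains the argument of `G`. -/
theorem level_dual_sum_le {B : matrixSpace N} {a : CoeffSpace N K} {γ q : ℝ} (hγ : 0 < γ) {k : ℕ}
    (h : ∑ I ∈ level N k, coeff a I * mfact I ≤
      (k : ℝ) ^ q * γ ^ k / (Nat.factorial k : ℝ) * mNum N k) :
    ∑ I ∈ level N k, coeff a I * mfact I / hafB (B : Matrix (Fin N) (Fin N) ℝ) I ≤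
      (k : ℝ) ^ q * mNum N k / (Nat.factorial (2 * k) : ℝ) * √(2 * γ * (bmin B)⁻¹) ^ (2 * k) := by
  have hb := bmin_pos B
  set e := bmin B ^ k * ((Nat.factorial (2 * k) : ℝ) / (2 ^ k * Nat.factorial k)) with he
  have he0 : 0 < e := by positivity
  calc _ ≤ ∑ I ∈ level N k, coeff a I * mfact I / e := by
        refine Finset.sum_le_sum fun I hI => ?_
        exact div_le_div_of_nonneg_left (mul_nonneg (coeff_nonneg a I) (mfact_pos I).le) he0
          (le_hafB B (mem_level.mp hI))
    _ = (∑ I ∈ level N k, coeff a I * mfact I) / e := by rw [Finset.sum_div]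
    _ ≤ ((k : ℝ) ^ q * γ ^ k / (Nat.factorial k : ℝ) * mNum N k) / e := by gcongr
    _ = _ := by
      rw [pow_mul, Real.sq_sqrt (by positivity), he, mul_pow, mul_pow, inv_pow]
      field_simp

theorem dual_tsum_le {B : matrixSpace N} {a : CoeffSpace N K} {γα γβ qα qβ : ℝ} (hγ : 0 < γβ)
    (hz : K = ⊤ → √(2 * γβ * (bmin B)⁻¹) < (N : ℝ)) (h : CoeffBounds γα γβ qα qβ a) :
    ∑' I, coeff a I * mfact I / hafB (B : Matrix (Fin N) (Fin N) ℝ) I ≤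
      coeff a 0 + gFun qβ K N (√(2 * γβ * (bmin B)⁻¹)) := by
  have hN : 1 ≤ N := Nat.one_le_iff_ne_zero.mpr (NeZero.ne N)
  refine Real.tsum_le_of_sum_le (dual_term_nonneg B a) fun s => ?_
  refine sum_le_of_level_sums_le (K := K) (dual_term_nonneg B a) (fun I hI => ?_)
    (fun M hM => ?_) s
  · exact exists_of_coeff_ne_zero (a := a) fun h0 => hI (by simp [h0])
  · rw [Finset.sum_range_succ', add_comm, level_zero, Finset.sum_singleton, hafB_zero]
    have h0 : mfact (0 : Fin N → ℕ) = 1 := by simp [mfact]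
    rw [h0, mul_one, div_one]
    refine add_le_add le_rfl (le_trans ?_ (sum_le_gFun hN qβ (Real.sqrt_nonneg _) hz (Icc 1 M) ?_))
    · rw [Finset.range_eq_Ico, Finset.sum_Ico_add' (fun k => ∑ I ∈ level N k,
        coeff a I * mfact I / hafB (B : Matrix (Fin N) (Fin N) ℝ) I) 0 M 1]
      refine Finset.sum_le_sum_of_subset_of_nonneg ?_ ?_ |>.trans
        (Finset.sum_le_sum (s := Icc 1 M) fun k hk => ?_)
      · intro k hk
        simp only [Finset.mem_Ico, Finset.mem_Icc] at hk ⊢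
        omega
      · exact fun k _ _ => Finset.sum_nonneg fun I _ => dual_term_nonneg B a I
      · rw [Finset.mem_Icc] at hk
        exact level_dual_sum_le hγ (h k hk.1 (le_trans (by exact_mod_cast hk.2) hM)).2.2
    · intro k hk
      rw [Finset.mem_Icc] at hk
      exact ⟨hk.1, le_trans (by exact_mod_cast hk.2) hM⟩

theorem qGBSP_eq {B : matrixSpace N} {a : CoeffSpace N K} (hP : (B, a) ∈ problemSpace N K) :
    qGBSP B a = 1 / gbsD B * (muHaf B a *
      ∑' I, coeff a I * mfact I / hafB (B : Matrix (Fin N) (Fin N) ℝ) I) := by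
  obtain ⟨h1, -, h2, -⟩ := hP
  unfold qGBSP muHaf
  rw [h1.tsum_mul_tsum h2
    (h1.mul_of_nonneg h2 (muHaf_term_nonneg B a) (dual_term_nonneg B a))]
  congr 1
  refine tsum_congr fun p => ?_
  ring

/-- Termwise, `Haf = Haf²/Haf ≤ (I!/d)/Haf`. One bound on `S` thus serves both as a numerator for
GBS-P and as a denominator for Monte Carlo. -/
theorem muHaf_le {B : matrixSpace N} {a : CoeffSpace N K} (hP : (B, a) ∈ problemSpace N K) :
    muHaf B a ≤ 1 / gbsD B *
      ∑' I, coeff a I * mfact I / hafB (B : Matrix (Fin N) (Fin N) ℝ) I := by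
  obtain ⟨h1, -, h2, -⟩ := hP
  rw [← tsum_mul_left]
  refine h1.tsum_le_tsum (fun I => ?_) (h2.mul_left _)
  by_cases h : coeff a I = 0
  · simp [h]
  · obtain ⟨k, -, hk⟩ := exists_of_coeff_ne_zero h
    have hp := hafB_pos B hk
    calc coeff a I * hafB (B : Matrix (Fin N) (Fin N) ℝ) I =
        coeff a I * (hafB (B : Matrix (Fin N) (Fin N) ℝ) I ^ 2 /
          hafB (B : Matrix (Fin N) (Fin N) ℝ) I) := by field_simp
      _ ≤ coeff a I * (mfact I / gbsD B / hafB (B : Matrix (Fin N) (Fin N) ℝ) I) := by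
        gcongr
        · exact coeff_nonneg a I
        · exact hafB_sq_le B hk
      _ = _ := by ring

end bounds

/-- Induction by the recurrence of central binomial coefficients; the step amounts to `4n(n+1) ≤
(2n+1)²`. -/
theorem sixteen_pow_le (n : ℕ) (hn : 1 ≤ n) : 16 ^ n ≤ 4 * n * n.centralBinom ^ 2 := by
  induction n, hn using Nat.le_induction with
  | base => simp [Nat.centralBinom]
  | succ n hn ih =>
    have h := Nat.succ_mul_centralBinom_succ n
    have h2 : (n + 1) * (4 * (n + 1) * (n + 1).centralBinom ^ 2) =
        16 * (2 * n + 1) ^ 2 * n.centralBinom ^ 2 := by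
      calc _ = 4 * ((n + 1) * (n + 1).centralBinom) ^ 2 := by ring
        _ = _ := by rw [h]; ring
    refine Nat.le_of_mul_le_mul_left ?_ (Nat.succ_pos n)
    rw [Nat.succ_eq_add_one, h2]
    calc (n + 1) * 16 ^ (n + 1) = 16 * (n + 1) * 16 ^ n := by ring
      _ ≤ 16 * (n + 1) * (4 * n * n.centralBinom ^ 2) := Nat.mul_le_mul_left _ ih
      _ = 16 * (4 * n * (n + 1)) * n.centralBinom ^ 2 := by ring
      _ ≤ _ := by
        refine Nat.mul_le_mul_right _ (Nat.mul_le_mul_left _ ?_)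
        nlinarith

theorem four_pow_div_le_centralBinom {n : ℕ} (hn : 1 ≤ n) :
    (4:ℝ) ^ n / (2 * √n) ≤ n.centralBinom := by
  have hn' : (0:ℝ) < n := by exact_mod_cast hn
  rw [div_le_iff₀ (by positivity)]
  refine le_of_sq_le_sq ?_ (by positivity)
  have h : ((16:ℝ)) ^ n ≤ 4 * n * (n.centralBinom : ℝ) ^ 2 := by exact_mod_cast sixteen_pow_le n hn
  rw [mul_pow, mul_pow, Real.sq_sqrt hn'.le, ← pow_mul, mul_comm n 2, pow_mul]
  norm_num
  linarith

/-- The elementary bound `C(2n,n) ≥ 4^n/(2√n)` has constant `1/2`, which is therefore at least as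
good as the constant required. -/
theorem exp_div_sqrt_pi_le : Real.exp (1 / 25 - 1 / 6) / √Real.pi ≤ 1 / 2 := by
  have h1 : (1.7724:ℝ) ≤ √Real.pi := by
    apply Real.le_sqrt_of_sq_le
    have := Real.pi_gt_d4
    norm_num at this ⊢
    linarith
  have h2 := Real.quadratic_le_exp_of_nonneg (show (0:ℝ) ≤ 19 / 150 by norm_num)
  have h3 : Real.exp (1 / 25 - 1 / 6) * Real.exp (19 / 150) = 1 := by
    rw [← Real.exp_add]; norm_num
  have h4 := Real.exp_pos (1 / 25 - 1 / 6)
  rw [div_le_iff₀ (by positivity)]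
  norm_num at h2 h1 h3 h4 ⊢
  nlinarith

/-- The weight `ψ` with `(ij)^q ≥ ψ(i + j)`. -/
noncomputable def convWeight (q : ℝ) (n : ℕ) : ℝ :=
  if 0 ≤ q then ((n : ℝ) / 2) ^ q else (n : ℝ) ^ (2 * q)

theorem convWeight_nonneg (q : ℝ) (n : ℕ) : 0 ≤ convWeight q n := by
  unfold convWeight
  split_ifs <;> positivity

theorem convWeight_le_rpow (q : ℝ) {n : ℕ} (hn : 1 ≤ n) : convWeight q n ≤ (n : ℝ) ^ q := by
  have hn' : (1:ℝ) ≤ n := by exact_mod_cast hn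
  unfold convWeight
  split_ifs with h
  · exact Real.rpow_le_rpow (by positivity) (by linarith) h
  · exact Real.rpow_le_rpow_of_exponent_le hn' (by linarith)

/-- For `i, j ≥ 1` one has `(i+j)/2 ≤ ij ≤ (i+j)²`. The sign of `q` decides which side is needed,
and this is the source of the two branches of `R`. -/
theorem convWeight_le_mul_rpow (q : ℝ) {i j : ℕ} (hi : 1 ≤ i) (hj : 1 ≤ j) :
    convWeight q (i + j) ≤ (i : ℝ) ^ q * (j : ℝ) ^ q := by
  have hi' : (1:ℝ) ≤ i := by exact_mod_cast hi
  have hj' : (1:ℝ) ≤ j := by exact_mod_cast hj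
  rw [← Real.mul_rpow (by positivity) (by positivity)]
  unfold convWeight
  push_cast
  split_ifs with h
  · exact Real.rpow_le_rpow (by positivity) (by nlinarith) h
  · rw [Real.rpow_mul (by positivity)]
    refine Real.rpow_le_rpow_of_nonpos (by positivity) ?_ (by linarith)
    rw [show (2:ℝ) = ((2:ℕ):ℝ) by norm_num, Real.rpow_natCast]
    nlinarith

theorem sum_antidiagonal_inv_factorial (n : ℕ) :
    ∑ ij ∈ antidiagonal n, 1 / ((Nat.factorial ij.1 : ℝ) * Nat.factorial ij.2) =
      2 ^ n / Nat.factorial n := by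
  have h : ∑ ij ∈ antidiagonal n, (n.choose ij.1 : ℝ) = 2 ^ n := by
    rw [Finset.Nat.sum_antidiagonal_eq_sum_range_succ_mk]
    exact_mod_cast Nat.sum_range_choose n
  rw [← h, Finset.sum_div]
  refine Finset.sum_congr rfl fun ij hij => ?_
  obtain rfl := HasAntidiagonal.mem_antidiagonal.mp hij
  rw [Nat.cast_add_choose]
  field_simp

section MC

variable {N : ℕ} {K : ℕ∞}

/-- The growth conditions start at degree one. If `i` or `j` is zero, one factor is `a_0` itself;
otherwise both growth bounds apply with factor `1`. The minimum covers both cases. -/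
theorem level_sum_mul_ge {a : CoeffSpace N K} {γα γβ qα qβ : ℝ} (hγ : 0 < γα)
    (h : CoeffBounds γα γβ qα qβ a) {n i j : ℕ} (hn : 1 ≤ n) (hnK : (n : ℕ∞) ≤ K)
    (hij : i + j = n) :
    min 1 (coeff a 0) * (convWeight qα n * γα ^ n) * (1 / ((Nat.factorial i : ℝ) * Nat.factorial j)) ≤
      (∑ I ∈ level N i, coeff a I) * ∑ J ∈ level N j, coeff a J := by
  have hA0 : ∑ I ∈ level N 0, coeff a I = coeff a 0 := by rw [level_zero, Finset.sum_singleton]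
  have hm0 : 0 ≤ min 1 (coeff a 0) := le_min zero_le_one (coeff_nonneg a 0)
  have hA : ∀ k, 1 ≤ k → k ≤ n → (k : ℝ) ^ qα * γα ^ k / (Nat.factorial k : ℝ) ≤
      ∑ I ∈ level N k, coeff a I := fun k hk hkn =>
    (h k hk (le_trans (by exact_mod_cast hkn) hnK)).1
  have h1 : min 1 (coeff a 0) * (convWeight qα n * γα ^ n / (Nat.factorial n : ℝ)) ≤
      coeff a 0 * ∑ I ∈ level N n, coeff a I := by
    refine mul_le_mul (min_le_right _ _) (le_trans ?_ (hA n hn le_rfl)) ?_ (coeff_nonneg a 0)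
    · gcongr
      exact convWeight_le_rpow qα hn
    · have := convWeight_nonneg qα n
      positivity
  rcases Nat.eq_zero_or_pos i with rfl | hi
  · have : j = n := by omega
    subst this
    rw [hA0]
    refine le_trans (le_of_eq ?_) h1
    simp; ring
  rcases Nat.eq_zero_or_pos j with rfl | hj
  · have : i = n := by omega
    subst this
    rw [hA0, mul_comm (∑ I ∈ level N i, coeff a I)]
    refine le_trans (le_of_eq ?_) h1
    simp; ring
  · subst hij
    have h2 := mul_le_mul (hA i hi (by omega)) (hA j hj (by omega)) (by positivity)
      (Finset.sum_nonneg fun I _ => coeff_nonneg a I)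
    refine le_trans ?_ h2
    have hw := convWeight_nonneg qα (i + j)
    calc _ ≤ 1 * (((i : ℝ) ^ qα * (j : ℝ) ^ qα) * γα ^ (i + j)) *
          (1 / ((Nat.factorial i : ℝ) * Nat.factorial j)) := by
          gcongr
          · exact min_le_left _ _
          · exact convWeight_le_mul_rpow qα hi hj
      _ = _ := by rw [pow_add]; field_simp

variable [NeZero N]

/-- The lower bound on `Haf(B_{I+J})` depends only on `n = i + j`, so it leaves the block. What
remains is `2^n/n!` times `(2n)!/(2^n n!)`, that is, `C(2n,n)`. -/
theorem block_ge {B : matrixSpace N} {a : CoeffSpace N K} {γα γβ qα qβ : ℝ} (hγ : 0 < γα)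
    (h : CoeffBounds γα γβ qα qβ a) {n : ℕ} (hn : 1 ≤ n) (hnK : (n : ℕ∞) ≤ K) :
    min 1 (coeff a 0) * (Real.exp (1 / 25 - 1 / 6) / √Real.pi) *
        (convWeight qα n * ((4 * γα * bmin B) ^ n / √n)) ≤
      ∑ ij ∈ antidiagonal n, ∑ I ∈ level N ij.1, ∑ J ∈ level N ij.2,
        coeff a I * coeff a J * hafB (B : Matrix (Fin N) (Fin N) ℝ) (I + J) := by
  have hb := bmin_pos B
  have hn' : (0:ℝ) < n := by exact_mod_cast hn
  have hw := convWeight_nonneg qα n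
  have hm0 : 0 ≤ min 1 (coeff a 0) := le_min zero_le_one (coeff_nonneg a 0)
  set E := bmin B ^ n * ((Nat.factorial (2 * n) : ℝ) / (2 ^ n * Nat.factorial n)) with hE
  have h1 : ∀ ij ∈ antidiagonal n,
      min 1 (coeff a 0) * (convWeight qα n * γα ^ n) *
        (1 / ((Nat.factorial ij.1 : ℝ) * Nat.factorial ij.2)) * E ≤
      ∑ I ∈ level N ij.1, ∑ J ∈ level N ij.2,
        coeff a I * coeff a J * hafB (B : Matrix (Fin N) (Fin N) ℝ) (I + J) := by
    intro ij hij
    refine (mul_le_mul_of_nonneg_right (level_sum_mul_ge hγ h hn hnK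
      (HasAntidiagonal.mem_antidiagonal.mp hij)) (by positivity)).trans ?_
    rw [Finset.sum_mul_sum, Finset.sum_mul]
    refine Finset.sum_le_sum fun I hI => ?_
    rw [Finset.sum_mul]
    refine Finset.sum_le_sum fun J hJ => ?_
    refine mul_le_mul_of_nonneg_left (le_hafB B ?_)
      (mul_nonneg (coeff_nonneg a I) (coeff_nonneg a J))
    rw [mem_level] at hI hJ
    have := HasAntidiagonal.mem_antidiagonal.mp hij
    simp only [Pi.add_apply, Finset.sum_add_distrib]
    omega
  refine le_trans ?_ (Finset.sum_le_sum h1)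
  rw [← Finset.sum_mul, ← Finset.mul_sum, sum_antidiagonal_inv_factorial]
  have hc : (n.centralBinom : ℝ) =
      Nat.factorial (2 * n) / (Nat.factorial n * Nat.factorial n) := by
    rw [Nat.centralBinom, Nat.cast_choose ℝ (by omega : n ≤ 2 * n)]
    congr 4
    omega
  calc _ ≤ min 1 (coeff a 0) * (1 / 2) * (convWeight qα n * ((4 * γα * bmin B) ^ n / √n)) := by
        exact mul_le_mul_of_nonneg_right (mul_le_mul_of_nonneg_left exp_div_sqrt_pi_le hm0)
          (by positivity)
    _ = min 1 (coeff a 0) * (convWeight qα n * (γα * bmin B) ^ n) * (4 ^ n / (2 * √n)) := by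
        rw [mul_assoc 4, mul_pow 4]
        field_simp
    _ ≤ min 1 (coeff a 0) * (convWeight qα n * (γα * bmin B) ^ n) * n.centralBinom := by
        gcongr
        exact four_pow_div_le_centralBinom hn
    _ = _ := by
        rw [hc, hE, mul_pow γα]
        field_simp

theorem rFun_eq (q : ℝ) (K : ℕ∞) (z : ℝ) : ∃ c s : ℝ, 0 < c ∧ rFun q K z = c * polylog s K z ∧
    ∀ n : ℕ, 1 ≤ n → c * (z ^ n / (n : ℝ) ^ s) =
      1 / (2 * √Real.pi) * (convWeight q n * (z ^ n / √n)) := by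
  unfold rFun convWeight
  split_ifs with h
  · refine ⟨2 ^ (-q) * (1 / (2 * √Real.pi)), 1 / 2 - q, by positivity, rfl, fun n hn => ?_⟩
    have hn' : (0:ℝ) < n := by exact_mod_cast hn
    rw [Real.rpow_sub hn', ← Real.sqrt_eq_rpow, Real.rpow_neg zero_le_two,
      Real.div_rpow hn'.le zero_le_two]
    field_simp
  · refine ⟨1 / (2 * √Real.pi), 1 / 2 - 2 * q, by positivity, rfl, fun n hn => ?_⟩
    have hn' : (0:ℝ) < n := by exact_mod_cast hn
    rw [Real.rpow_sub hn', ← Real.sqrt_eq_rpow]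
    field_simp

theorem qMC_ge {B : matrixSpace N} {a : CoeffSpace N K} {γα γβ qα qβ : ℝ} (hγ : 0 < γα)
    (hP : (B, a) ∈ problemSpace N K) (h : CoeffBounds γα γβ qα qβ a) (ha : 0 < coeff a 0) :
    min 1 (coeff a 0) * (2 * Real.exp (1 / 25 - 1 / 6)) * rFun qα K (4 * γα * bmin B) ≤
      qMC B a := by
  obtain ⟨-, -, -, hs⟩ := hP
  obtain ⟨c, s, hc, hR, ht⟩ := rFun_eq qα K (4 * γα * bmin B)
  have hb := bmin_pos B
  set m := min 1 (coeff a 0) with hm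
  have hm0 : 0 < m := lt_min zero_lt_one ha
  have hz : 0 ≤ 4 * γα * bmin B := by positivity
  have hQ : 0 ≤ qMC B a := tsum_nonneg (qMC_term_nonneg B a)
  have hk : 0 < m * (2 * Real.exp (1 / 25 - 1 / 6)) * c := by positivity
  rw [hR, ← mul_assoc, ← le_div_iff₀' hk]
  -- Finite partial sums suffice. Only blocks of total level at most `K` are kept; the rest of
  -- `Q^{MC}` is nonnegative.
  refine polylog_le_of_sum_le s (by positivity) hz fun M hM => ?_
  rw [le_div_iff₀' hk, Finset.mul_sum]
  refine le_trans (Finset.sum_le_sum fun n hn => ?_)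
    (sum_blocks_le_tsum (qMC_term_nonneg B a) hs M)
  rw [Finset.mem_Icc] at hn
  refine le_trans (le_of_eq ?_) (block_ge (B := B) hγ h hn.1 (le_trans (by exact_mod_cast hn.2) hM))
  rw [mul_assoc _ c, ht n hn.1, ← hm]
  field_simp

end MC

/-- The explicit sample size bounds. -/
theorem sample_size_bounds (N : ℕ) (K : ℕ∞) (ζ p ε δ γα γβ qα qβ CG CD CR : ℝ)
    (hN : 1 ≤ N) (hε : 0 < ε) (hδ : 0 < δ)
    (hγα : 0 < γα) (hγβ : 0 < γβ) (hCG : 0 < CG) (hCD : 0 < CD)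
    (hζ : 0 < ζ) (hCR : 1 < CR)
    (B : matrixSpace N) (a : CoeffSpace N K) (hP : (B, a) ∈ problemSpace N K)
    (hB : B ∈ uniformSpace N K ζ p γα γβ qα qβ CG CD CR)
    (ha : CoeffBounds γα γβ qα qβ a) (ha0 : coeff a 0 ≠ 0) :
    nGBSP ε δ B a <
      1 / (ε ^ 2 * δ) *
        (CD * (N : ℝ) ^ p + CG * CD * (N : ℝ) ^ (3 + p) / coeff a 0 - 1) ∧
    1 / (ε ^ 2 * δ) *
        (min 1 (coeff a 0) * (Real.exp (1 / 25 - 1 / 6) / √Real.pi) *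
            (ζ * (N : ℝ) ^ 2) ^ (2 * qα - 1 / 2) * CR ^ (ζ * (N : ℝ) ^ 2) /
          (CD * (N : ℝ) ^ p * (coeff a 0 + CG * (N : ℝ) ^ 3)) ^ 2 - 1) <
      nMC ε δ B a := by
  have : NeZero N := ⟨by omega⟩
  have hN0 : (0:ℝ) < N := by exact_mod_cast hN
  obtain ⟨hdom, hG, hR, hd⟩ := hB
  have ha0' : 0 < coeff a 0 := lt_of_le_of_ne (coeff_nonneg a 0) (Ne.symm ha0)
  have hμ := coeff_zero_le_muHaf hP.1
  have hS := dual_tsum_le (B := B) hγβ (fun hK => (hdom hK).1) ha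
  have hμS := muHaf_le hP
  have hQ := qGBSP_eq hP
  have hMC := qMC_ge hγα hP ha ha0'
  have hd0 : 0 < 1 / gbsD B := one_div_pos.mpr (gbsD_pos B)
  set S := ∑' I, coeff a I * mfact I / hafB (B : Matrix (Fin N) (Fin N) ℝ) I with hSdef
  set μ := muHaf B a with hμdef
  set g := 1 / gbsD B with hg
  have hμ0 : 0 < μ := lt_of_lt_of_le ha0' hμ
  have hNp : 0 < (N:ℝ) ^ p := by positivity
  have hS' : S < coeff a 0 + CG * (N:ℝ) ^ 3 := by linarith
  have hT : 0 < coeff a 0 + CG * (N:ℝ) ^ 3 := by positivity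
  have hgS : g * S < CD * (N:ℝ) ^ p * (coeff a 0 + CG * (N:ℝ) ^ 3) :=
    mul_lt_mul'' hd hS' hd0.le (by
      exact tsum_nonneg (dual_term_nonneg B a))
  have hεδ : 0 < ε ^ 2 * δ := by positivity
  have hn : ∀ Q : ℝ, (Q - μ ^ 2) / (δ * ε ^ 2 * μ ^ 2) = 1 / (ε ^ 2 * δ) * (Q / μ ^ 2 - 1) := by
    intro Q
    field_simp
  constructor
  · unfold nGBSP
    rw [hn, hQ]
    refine mul_lt_mul_of_pos_left ?_ (by positivity)
    refine sub_lt_sub_right ?_ 1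
    have e1 : g * (μ * S) / μ ^ 2 = g * S / μ := by field_simp
    rw [e1, div_lt_iff₀ hμ0, Real.rpow_add hN0]
    have e2 : (N:ℝ) ^ (3:ℝ) = (N:ℝ) ^ 3 := by
      rw [show (3:ℝ) = ((3:ℕ):ℝ) by norm_num, Real.rpow_natCast]
    rw [e2]
    calc g * S < CD * (N:ℝ) ^ p * (coeff a 0 + CG * (N:ℝ) ^ 3) := hgS
      _ = (CD * (N : ℝ) ^ p + CG * CD * ((N : ℝ) ^ 3 * (N:ℝ) ^ p) / coeff a 0) * coeff a 0 := by
          field_simp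
      _ ≤ _ := by gcongr
  · unfold nMC
    rw [hn]
    refine mul_lt_mul_of_pos_left ?_ (by positivity)
    refine sub_lt_sub_right ?_ 1
    have hm0 : 0 < min 1 (coeff a 0) := lt_min zero_lt_one ha0'
    -- Monte Carlo is bad only if `μ²` is small against `Q^{MC}`; here `μ ≤ S/d` bounds `μ`
    -- polynomially in `N`.
    have hμ2 : μ ^ 2 ≤ (CD * (N:ℝ) ^ p * (coeff a 0 + CG * (N:ℝ) ^ 3)) ^ 2 :=
      pow_le_pow_left₀ hμ0.le (hμS.trans hgS.le) 2
    have h1 : min 1 (coeff a 0) * (Real.exp (1 / 25 - 1 / 6) / √Real.pi) *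
        (ζ * (N : ℝ) ^ 2) ^ (2 * qα - 1 / 2) * CR ^ (ζ * (N : ℝ) ^ 2) < qMC B a := by
      refine lt_of_lt_of_le ?_ hMC
      refine lt_of_eq_of_lt ?_ (mul_lt_mul_of_pos_left hR (by positivity :
        0 < min 1 (coeff a 0) * (2 * Real.exp (1 / 25 - 1 / 6))))
      field_simp
    have hCR0 : 0 < CR := by linarith
    have hX : 0 < min 1 (coeff a 0) * (Real.exp (1 / 25 - 1 / 6) / √Real.pi) *
        (ζ * (N : ℝ) ^ 2) ^ (2 * qα - 1 / 2) * CR ^ (ζ * (N : ℝ) ^ 2) := by positivity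
    calc _ ≤ _ := div_le_div_of_nonneg_left hX.le (by positivity) hμ2
      _ < _ := by gcongr

end GBS

/-! ### Growth rates as `N → ∞`. -/

namespace GBS

open Filter

/-- After taking logarithms, `ζN²(log C_R - log ρ)` outweighs all other terms, which are `o(N²)`.
The factor `2` leaves room for the `-1` in the sample size and `N^e` for the polynomial denominator.
-/
theorem eventually_two_mul_rpow_le {ζ κ e CR ρ : ℝ} {qα : ℕ → ℝ} (hζ : 0 < ζ) (hκ : 0 < κ)
    (hq : Dominates ζ qα) (hρ : 0 < ρ) (hρC : ρ < CR) :
    ∀ᶠ N : ℕ in atTop, 2 * ρ ^ (ζ * (N : ℝ) ^ 2) * (N : ℝ) ^ e ≤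
      κ * (ζ * (N : ℝ) ^ 2) ^ (2 * qα N - 1 / 2) * CR ^ (ζ * (N : ℝ) ^ 2) := by
  have hCR : 0 < CR := hρ.trans hρC
  have hsq : Tendsto (fun N : ℕ => (N:ℝ) ^ 2) atTop atTop :=
    (tendsto_pow_atTop two_ne_zero).comp tendsto_natCast_atTop_atTop
  have h1 : Tendsto (fun N : ℕ => (Real.log κ - Real.log 2) / (N:ℝ) ^ 2) atTop (𝓝 0) :=
    hsq.const_div_atTop _
  have h2 : Tendsto (fun N : ℕ => e * (Real.log N / (N:ℝ) ^ 2)) atTop (𝓝 0) := by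
    have h : Tendsto (fun x : ℝ => Real.log x / x ^ 2) atTop (𝓝 0) := by
      have := (isLittleO_log_rpow_atTop (r := 2) zero_lt_two).tendsto_div_nhds_zero
      simpa using this
    simpa using (h.comp tendsto_natCast_atTop_atTop).const_mul e
  have h3 := (hq.add h1).sub h2
  have hlog : Real.log ρ < Real.log CR := Real.log_lt_log hρ hρC
  have hneg : -(ζ * (Real.log CR - Real.log ρ)) < 0 + 0 - 0 := by
    have := mul_pos hζ (sub_pos.mpr hlog)
    linarith
  filter_upwards [h3.eventually (lt_mem_nhds hneg), eventually_ge_atTop 1] with N hN hN1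
  have hN0 : (0:ℝ) < N := by exact_mod_cast hN1
  have hN2 : (0:ℝ) < (N:ℝ) ^ 2 := by positivity
  have hT : 0 < ζ * (N:ℝ) ^ 2 := by positivity
  have h4 := mul_lt_mul_of_pos_right hN hN2
  have h5 : ((2 * qα N - 1 / 2) * Real.log (ζ * (N : ℝ) ^ 2) / (N : ℝ) ^ 2 +
      (Real.log κ - Real.log 2) / (N:ℝ) ^ 2 - e * (Real.log N / (N:ℝ) ^ 2)) * (N:ℝ) ^ 2 =
      (2 * qα N - 1 / 2) * Real.log (ζ * (N : ℝ) ^ 2) + (Real.log κ - Real.log 2) -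
        e * Real.log N := by
    field_simp
  rw [h5] at h4
  rw [← Real.log_le_log_iff (by positivity) (by positivity), Real.log_mul (by positivity)
    (by positivity), Real.log_mul (by positivity) (by positivity), Real.log_mul (by positivity)
    (by positivity), Real.log_mul (by positivity) (by positivity), Real.log_rpow hρ,
    Real.log_rpow hN0, Real.log_rpow hT, Real.log_rpow hCR]
  nlinarith

theorem sample_size_growth (ζ p CG CD CR l u : ℝ) (qα : ℕ → ℝ)
    (hζ : 0 < ζ) (hCG : 0 < CG) (hCD : 0 < CD) (hCR : 1 < CR) (hl : 0 < l)
    (hlu : l ≤ u) (hq : Dominates ζ qα) :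
    ∃ C : ℝ, 0 < C ∧ ∀ ρ : ℝ, 1 < ρ → ρ < CR →
      ∃ (c : ℝ) (N₀ : ℕ), 0 < c ∧ 1 ≤ N₀ ∧
        ∀ (N : ℕ) (K : ℕ∞) (ε δ γα γβ qβ : ℝ),
          N₀ ≤ N → LargeDegree ζ N K → 0 < ε → ε < 1 → 0 < δ → δ < 1 → 0 < γα → 0 < γβ →
          ∀ (B : matrixSpace N) (a : CoeffSpace N K), (B, a) ∈ problemSpace N K →
            B ∈ uniformSpace N K ζ p γα γβ (qα N) qβ CG CD CR →
            CoeffBounds γα γβ (qα N) qβ a → l ≤ coeff a 0 → coeff a 0 ≤ u →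
            nGBSP ε δ B a ≤ 1 / (ε ^ 2 * δ) * (C * (N : ℝ) ^ (3 + p)) ∧
            1 / (ε ^ 2 * δ) * (c * ρ ^ (ζ * (N : ℝ) ^ 2)) ≤ nMC ε δ B a := by
  have hu : 0 < u := hl.trans_le hlu
  refine ⟨CD + CG * CD / l, by positivity, fun ρ hρ hρC => ?_⟩
  set k := min 1 l * (Real.exp (1 / 25 - 1 / 6) / √Real.pi) with hk
  have hm : 0 < min 1 l := lt_min zero_lt_one hl
  have hk0 : 0 < k := by positivity
  have hev := eventually_two_mul_rpow_le (e := 2 * (p + 3)) hζ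
    (show 0 < k / (CD * (u + CG)) ^ 2 by positivity) hq (by linarith) hρC
  obtain ⟨N₀, hN₀⟩ := eventually_atTop.mp hev
  -- The constant `c = 1` works because every fixed factor has been absorbed into the choice of
  -- `N₀`.
  refine ⟨1, max 1 N₀, one_pos, le_max_left _ _, ?_⟩
  intro N K ε δ γα γβ qβ hN _ hε _ hδ _ hγα hγβ B a hP hB ha hla hau
  have hN1 : 1 ≤ N := (le_max_left _ _).trans hN
  have hNr : (1:ℝ) ≤ N := by exact_mod_cast hN1
  have hN0 : (0:ℝ) < N := by linarith
  have ha0 : 0 < coeff a 0 := hl.trans_le hla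
  have hev := hN₀ N ((le_max_right _ _).trans hN)
  obtain ⟨h1, h2⟩ := sample_size_bounds N K ζ p ε δ γα γβ (qα N) qβ CG CD CR hN1 hε hδ hγα hγβ
    hCG hCD hζ hCR B a hP hB ha ha0.ne'
  constructor
  · refine h1.le.trans (mul_le_mul_of_nonneg_left ?_ (by positivity))
    have h3 : (N:ℝ) ^ p ≤ (N:ℝ) ^ (3 + p) :=
      Real.rpow_le_rpow_of_exponent_le hNr (by linarith)
    have h4 : CG * CD * (N : ℝ) ^ (3 + p) / coeff a 0 ≤ CG * CD * (N : ℝ) ^ (3 + p) / l := by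
      gcongr
    have h5 : CD * (N:ℝ) ^ p ≤ CD * (N:ℝ) ^ (3 + p) := by gcongr
    calc _ ≤ CD * (N:ℝ) ^ (3 + p) + CG * CD * (N : ℝ) ^ (3 + p) / l := by linarith
      _ = _ := by ring
  · refine le_trans (mul_le_mul_of_nonneg_left ?_ (by positivity)) h2.le
    have hT : 0 < ζ * (N:ℝ) ^ 2 := by positivity
    have hρT : 1 ≤ ρ ^ (ζ * (N : ℝ) ^ 2) := Real.one_le_rpow hρ.le hT.le
    rw [one_mul, le_sub_iff_add_le]
    have hden : CD * (N : ℝ) ^ p * (coeff a 0 + CG * (N : ℝ) ^ 3) ≤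
        CD * (u + CG) * (N:ℝ) ^ (p + 3) := by
      have e3 : (N:ℝ) ^ (p + 3) = (N:ℝ) ^ p * (N:ℝ) ^ 3 := by
        rw [Real.rpow_add hN0, show (3:ℝ) = ((3:ℕ):ℝ) by norm_num, Real.rpow_natCast]
      have h3 : coeff a 0 + CG * (N : ℝ) ^ 3 ≤ (u + CG) * (N:ℝ) ^ 3 := by
        have : (1:ℝ) ≤ (N:ℝ) ^ 3 := one_le_pow₀ hNr
        nlinarith
      calc _ ≤ CD * (N : ℝ) ^ p * ((u + CG) * (N:ℝ) ^ 3) := by gcongr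
        _ = _ := by rw [e3]; ring
    have e6 : (N:ℝ) ^ (2 * (p + 3)) = ((N:ℝ) ^ (p + 3)) ^ 2 := by
      rw [mul_comm, Real.rpow_mul hN0.le, show (2:ℝ) = ((2:ℕ):ℝ) by norm_num, Real.rpow_natCast]
    have hCR0 : 0 < CR := by linarith
    calc ρ ^ (ζ * (N : ℝ) ^ 2) + 1 ≤ 2 * ρ ^ (ζ * (N : ℝ) ^ 2) := by linarith
      _ ≤ k * (ζ * (N : ℝ) ^ 2) ^ (2 * qα N - 1 / 2) * CR ^ (ζ * (N : ℝ) ^ 2) /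
          (CD * (u + CG) * (N:ℝ) ^ (p + 3)) ^ 2 := by
        rw [le_div_iff₀ (by positivity)]
        rw [e6] at hev
        have h7 : (0:ℝ) < (CD * (u + CG)) ^ 2 := by positivity
        have h8 := mul_le_mul_of_nonneg_right hev h7.le
        calc _ = 2 * ρ ^ (ζ * (N : ℝ) ^ 2) * ((N:ℝ) ^ (p + 3)) ^ 2 * (CD * (u + CG)) ^ 2 := by
              ring
          _ ≤ _ := h8
          _ = _ := by field_simp
      _ ≤ _ := by
        rw [hk]
        have : 0 < coeff a 0 + CG * (N : ℝ) ^ 3 := by positivity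
        gcongr

end GBS

/-! ### Parameters `q_α = q_β = -2N` satisfying the conditions on `G`, `R` and `d`. -/

namespace GBS

open Finset Filter

/-- The term `k = 1` is undamped and gives `N²/2`. For `k ≥ 2` the weight `k^(-2N) ≤ 4^(-N)`
compensates `z^{2k}/(2k)! ≤ e^z ≤ 4^N`. -/
theorem hFun_le {N : ℕ} (hN : 1 ≤ N) {z : ℝ} (hz : 0 ≤ z) (hzN : z ≤ N) :
    hFun (-2 * (N : ℝ)) (N / 2) z ≤ (N : ℝ) ^ 2 / 2 + N := by
  have hN0 : (0:ℝ) < N := by exact_mod_cast hN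
  have hexp : Real.exp z ≤ 4 ^ N := by
    calc Real.exp z ≤ Real.exp (N * 1) := Real.exp_le_exp.mpr (by linarith)
      _ = Real.exp 1 ^ N := Real.exp_nat_mul _ _
      _ ≤ 4 ^ N := pow_le_pow_left₀ (Real.exp_pos _).le
          (by linarith [Real.exp_one_lt_d9]) N
  have hterm : ∀ k ∈ Icc 1 (N / 2),
      (k : ℝ) ^ (-2 * (N:ℝ)) / (Nat.factorial (2 * k) : ℝ) * z ^ (2 * k) ≤
        (if k = 1 then (N:ℝ) ^ 2 / 2 else 0) + 1 := by
    intro k hk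
    rw [Finset.mem_Icc] at hk
    split_ifs with h1
    · subst h1
      have : z ^ 2 ≤ (N:ℝ) ^ 2 := pow_le_pow_left₀ hz hzN 2
      simp
      linarith
    · have hk2 : (2:ℝ) ≤ k := by exact_mod_cast (by omega : 2 ≤ k)
      have h2 : (k : ℝ) ^ (-2 * (N:ℝ)) ≤ (4 ^ N)⁻¹ := by
        calc (k : ℝ) ^ (-2 * (N:ℝ)) ≤ 2 ^ (-2 * (N:ℝ)) :=
              Real.rpow_le_rpow_of_nonpos two_pos hk2 (by nlinarith)
          _ = (4 ^ N)⁻¹ := by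
              rw [neg_mul, Real.rpow_neg zero_le_two, Real.rpow_mul zero_le_two,
                Real.rpow_natCast]
              norm_num
      have h3 : z ^ (2 * k) / (Nat.factorial (2 * k) : ℝ) ≤ 4 ^ N :=
        (Real.pow_div_factorial_le_exp z hz (2 * k)).trans hexp
      calc _ = (k : ℝ) ^ (-2 * (N:ℝ)) * (z ^ (2 * k) / (Nat.factorial (2 * k) : ℝ)) := by ring
        _ ≤ (4 ^ N)⁻¹ * 4 ^ N := mul_le_mul h2 h3 (by positivity) (by positivity)
        _ = 0 + 1 := by rw [inv_mul_cancel₀ (by positivity)]; ring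
  unfold hFun
  refine (Finset.sum_le_sum hterm).trans ?_
  rw [Finset.sum_add_distrib, Finset.sum_ite_eq', Finset.sum_const, Nat.card_Icc, nsmul_eq_mul]
  refine add_le_add ?_ ?_
  · split_ifs
    · exact le_rfl
    · positivity
  · rw [mul_one]
    exact_mod_cast (by omega : N / 2 + 1 - 1 ≤ N)

theorem polylog_zero_le {N : ℕ} {y : ℝ} (hy : 0 ≤ y) (hy2 : y ≤ 2) :
    polylog 0 (N : ℕ∞) y ≤ N * 2 ^ N := by
  refine polylog_le_of_sum_le 0 (by positivity) hy fun M hM => ?_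
  have hM : M ≤ N := by exact_mod_cast hM
  calc ∑ k ∈ Icc 1 M, y ^ k / (k : ℝ) ^ (0:ℝ) ≤ ∑ k ∈ Icc 1 M, (2:ℝ) ^ N := by
        refine Finset.sum_le_sum fun k hk => ?_
        rw [Finset.mem_Icc] at hk
        rw [Real.rpow_zero, div_one]
        exact (pow_le_pow_left₀ hy hy2 k).trans (pow_le_pow_right₀ one_le_two (by omega))
    _ = M * 2 ^ N := by simp
    _ ≤ _ := by
        have : (M:ℝ) ≤ N := by exact_mod_cast hM
        gcongr

theorem polylog_le_geometric {s : ℝ} (hs : 0 ≤ s) (K : ℕ∞) {y c : ℝ} (hy : 0 ≤ y) (hyc : y ≤ c)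
    (hc : c < 1) : polylog s K y ≤ (1 - c)⁻¹ := by
  have hc0 : 0 ≤ c := hy.trans hyc
  refine polylog_le_of_sum_le s (inv_nonneg.mpr (by linarith)) hy fun M _ => ?_
  rw [← tsum_geometric_of_lt_one hc0 hc]
  refine le_trans (Finset.sum_le_sum fun k hk => ?_)
    ((summable_geometric_of_lt_one hc0 hc).sum_le_tsum (Icc 1 M) fun k _ => by positivity)
  rw [Finset.mem_Icc] at hk
  have h1 : (1:ℝ) ≤ (k:ℝ) ^ s := Real.one_le_rpow (by exact_mod_cast hk.1) hs
  exact (div_le_self (by positivity) h1).trans (pow_le_pow_left₀ hy hyc k)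

theorem gFun_lt {N : ℕ} (hN : 14 ≤ N) (K : ℕ∞) {z : ℝ} (hz : 0 ≤ z) (hzN : z ≤ 0.95 * N) :
    gFun (-2 * (N : ℝ)) K N z < (N : ℝ) ^ 3 := by
  have hN14 : (14:ℝ) ≤ N := by exact_mod_cast hN
  have hN0 : (0:ℝ) < N := by linarith
  have h1 := hFun_le (N := N) (by omega) hz (by linarith)
  have h2 : polylog 0 (N : ℕ∞) (2 * z / N) ≤ N * 2 ^ N := by
    refine polylog_zero_le (by positivity) ?_
    rw [div_le_iff₀ hN0]
    linarith
  have hy : z ^ N / (N:ℝ) ^ N ≤ 0.95 := by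
    rw [← div_pow]
    have h : z / N ≤ 0.95 := by rw [div_le_iff₀ hN0]; exact hzN
    calc (z / N) ^ N ≤ 0.95 ^ N := pow_le_pow_left₀ (by positivity) h N
      _ ≤ 0.95 ^ 1 := pow_le_pow_of_le_one (by norm_num) (by norm_num) (by omega)
      _ = _ := by norm_num
  have h3 : polylog (1 / 2 - (N : ℝ) / 2 - -2 * (N:ℝ)) (sENat N K) (z ^ N / (N : ℝ) ^ N) ≤ 20 := by
    refine (polylog_le_geometric (by linarith) _ (by positivity) hy (by norm_num)).trans ?_
    norm_num
  have c1 : (2 : ℝ) ^ (((N : ℝ) - 1) / 2 - min (-2 * (N:ℝ)) 0) ≤ 8 ^ N := by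
    rw [min_eq_left (by linarith)]
    calc (2 : ℝ) ^ (((N : ℝ) - 1) / 2 - -2 * (N:ℝ)) ≤ 2 ^ (3 * (N:ℝ)) :=
          Real.rpow_le_rpow_of_exponent_le one_le_two (by linarith)
      _ = 8 ^ N := by
          rw [Real.rpow_mul zero_le_two, Real.rpow_natCast]; norm_num
  have c2 : Real.pi ^ (((N : ℝ) - 1) / 2) ≤ 4 ^ N := by
    calc Real.pi ^ (((N : ℝ) - 1) / 2) ≤ Real.pi ^ (N:ℝ) :=
          Real.rpow_le_rpow_of_exponent_le (by linarith [Real.pi_gt_three]) (by linarith)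
      _ = Real.pi ^ N := Real.rpow_natCast _ _
      _ ≤ 4 ^ N := pow_le_pow_left₀ Real.pi_pos.le Real.pi_le_four N
  have c3 : (N : ℝ) ^ (-2 * (N:ℝ) - 1 / 2) ≤ (((N:ℝ) ^ 2) ^ N)⁻¹ := by
    calc (N : ℝ) ^ (-2 * (N:ℝ) - 1 / 2) ≤ (N:ℝ) ^ (-(2 * (N:ℝ))) :=
          Real.rpow_le_rpow_of_exponent_le (by linarith) (by linarith)
      _ = _ := by
          rw [Real.rpow_neg hN0.le, Real.rpow_mul hN0.le, Real.rpow_natCast]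
          norm_num
  have c4 : Real.exp ((N : ℝ) / 12) ≤ 3 ^ N := by
    calc Real.exp ((N : ℝ) / 12) ≤ Real.exp (N * 1) := Real.exp_le_exp.mpr (by linarith)
      _ = Real.exp 1 ^ N := Real.exp_nat_mul _ _
      _ ≤ 3 ^ N := pow_le_pow_left₀ (Real.exp_pos _).le (by linarith [Real.exp_one_lt_d9]) N
  have h4 : (2 : ℝ) ^ (((N : ℝ) - 1) / 2 - min (-2 * (N:ℝ)) 0) *
      Real.pi ^ (((N : ℝ) - 1) / 2) * (N : ℝ) ^ (-2 * (N:ℝ) - 1 / 2) * Real.exp ((N : ℝ) / 12) *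
      polylog 0 (N : ℕ∞) (2 * z / N) *
      polylog (1 / 2 - (N : ℝ) / 2 - -2 * (N:ℝ)) (sENat N K) (z ^ N / (N : ℝ) ^ N) ≤
      20 * N := by
    have p1 := polylog_nonneg 0 (N : ℕ∞) (show 0 ≤ 2 * z / N by positivity)
    have p2 := polylog_nonneg (1 / 2 - (N : ℝ) / 2 - -2 * (N:ℝ)) (sENat N K)
      (show 0 ≤ z ^ N / (N : ℝ) ^ N by positivity)
    -- Here `192 = 8·4·3·2` collects the bases of all exponential factors, and `14² = 196` explains
    -- the condition `N ≥ 14`.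
    have h5 : (192:ℝ) ^ N * (((N:ℝ) ^ 2) ^ N)⁻¹ ≤ 1 := by
      rw [← div_eq_mul_inv, div_le_one (by positivity)]
      exact pow_le_pow_left₀ (by norm_num) (by nlinarith) N
    calc _ ≤ (8:ℝ) ^ N * 4 ^ N * (((N:ℝ) ^ 2) ^ N)⁻¹ * 3 ^ N * (N * 2 ^ N) * 20 := by
          gcongr
      _ = ((8 * 4 * 3 * 2 : ℝ) ^ N * (((N:ℝ) ^ 2) ^ N)⁻¹) * (20 * N) := by
          rw [mul_pow, mul_pow, mul_pow]; ring
      _ ≤ 1 * (20 * N) := by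
          norm_num at h5 ⊢
          exact mul_le_of_le_one_left (by positivity) h5
      _ = _ := by ring
  unfold gFun
  nlinarith [mul_pos hN0 hN0]

/-- A single term of the polylogarithm suffices, at `k = ⌈T⌉` with `T = ζN²`. Rounding `T` up costs
at most a factor `e` in `k^m`, where `m = 4N + 1/2 ≤ T`, and `(1.08/1.05)^T` exceeds it. -/
theorem eventually_rFun_gt {ζ : ℝ} (hζ : 0 < ζ) : ∀ᶠ N : ℕ in atTop, ∀ K : ℕ,
    ζ * (N : ℝ) ^ 2 ≤ K → ∀ x : ℝ, 1.08 ≤ x →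
    1 / (2 * √Real.pi) * (ζ * (N : ℝ) ^ 2) ^ (2 * (-2 * (N : ℝ)) - 1 / 2) *
      1.05 ^ (ζ * (N : ℝ) ^ 2) < rFun (-2 * (N : ℝ)) K x := by
  have hL : 0 < Real.log (1.08 / 1.05) := Real.log_pos (by norm_num)
  filter_upwards [eventually_ge_atTop 1,
    tendsto_natCast_atTop_atTop.eventually_ge_atTop (5 / ζ),
    tendsto_natCast_atTop_atTop.eventually_gt_atTop (1 / (ζ * Real.log (1.08 / 1.05)))]
    with N hN1 hN2 hN3 K hK x hx
  have hNr : (1:ℝ) ≤ N := by exact_mod_cast hN1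
  have hN0 : (0:ℝ) < N := by linarith
  set T := ζ * (N:ℝ) ^ 2 with hTdef
  have hT : 0 < T := by positivity
  rw [div_le_iff₀ hζ] at hN2
  rw [div_lt_iff₀ (by positivity)] at hN3
  have hT1 : 4 * (N:ℝ) + 1 / 2 ≤ T := by rw [hTdef]; nlinarith
  have hT2 : 1 < T * Real.log (1.08 / 1.05) := by
    rw [hTdef]
    have : (N:ℝ) * (ζ * Real.log (1.08 / 1.05)) ≤ (N:ℝ) ^ 2 * (ζ * Real.log (1.08 / 1.05)) := by
      gcongr
      nlinarith
    linarith
  set k := ⌈T⌉₊ with hk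
  have hk1 : 1 ≤ k := Nat.one_le_ceil_iff.mpr hT
  have hkK : k ≤ K := Nat.ceil_le.mpr hK
  have hTk : T ≤ k := Nat.le_ceil T
  have hkT : (k:ℝ) ≤ T + 1 := (Nat.ceil_lt_add_one hT.le).le
  have hk0 : (0:ℝ) < k := by exact_mod_cast hk1
  have hR : 1 / (2 * √Real.pi) * (x ^ k / (k:ℝ) ^ (1 / 2 - 2 * (-2 * (N:ℝ)))) ≤
      rFun (-2 * (N : ℝ)) K x := by
    unfold rFun
    rw [if_neg (by linarith)]
    have h := sum_le_polylog (1 / 2 - 2 * (-2 * (N:ℝ))) (K := (K : ℕ∞)) (z := x) (by linarith)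
      (fun h => by simp at h) {k} (fun j hj => by
        rw [Finset.mem_singleton] at hj
        subst hj
        exact ⟨hk1, by exact_mod_cast hkK⟩)
    rw [Finset.sum_singleton] at h
    exact mul_le_mul_of_nonneg_left h (by positivity)
  refine lt_of_lt_of_le ?_ hR
  rw [mul_assoc]
  refine mul_lt_mul_of_pos_left ?_ (by positivity)
  have e1 : 2 * (-2 * (N : ℝ)) - 1 / 2 = -(1 / 2 - 2 * (-2 * (N:ℝ))) := by ring
  set m := 1 / 2 - 2 * (-2 * (N:ℝ)) with hm
  have hm0 : 0 < m := by rw [hm]; linarith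
  rw [e1, Real.rpow_neg hT.le]
  have hx1 : (1.08:ℝ) ^ T ≤ x ^ k := by
    calc (1.08:ℝ) ^ T ≤ (1.08:ℝ) ^ (k:ℝ) :=
          Real.rpow_le_rpow_of_exponent_le (by norm_num) hTk
      _ = 1.08 ^ k := Real.rpow_natCast _ _
      _ ≤ x ^ k := pow_le_pow_left₀ (by norm_num) hx k
  have hkm : (k:ℝ) ^ m ≤ T ^ m * Real.exp 1 := by
    have h1 : (k:ℝ) ≤ T * Real.exp (1 / T) := by
      have := Real.add_one_le_exp (1 / T)
      calc (k:ℝ) ≤ T * (1 / T + 1) := by rw [mul_add, mul_one_div_cancel hT.ne']; linarith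
        _ ≤ _ := by gcongr
    calc (k:ℝ) ^ m ≤ (T * Real.exp (1 / T)) ^ m := Real.rpow_le_rpow hk0.le h1 hm0.le
      _ = T ^ m * Real.exp (1 / T * m) := by
        rw [Real.mul_rpow hT.le (Real.exp_pos _).le, ← Real.exp_mul]
      _ ≤ T ^ m * Real.exp 1 := by
        gcongr
        rw [one_div_mul_eq_div, div_le_one hT, hm]
        linarith
  have h108 : (1.05:ℝ) ^ T * Real.exp 1 < 1.08 ^ T := by
    have h1 : Real.exp 1 < (1.08 / 1.05 : ℝ) ^ T := by
      rw [Real.rpow_def_of_pos (by norm_num)]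
      exact Real.exp_lt_exp.mpr (by linarith)
    rw [Real.div_rpow (by norm_num) (by norm_num), lt_div_iff₀ (by positivity)] at h1
    linarith
  rw [lt_div_iff₀ (by positivity)]
  have hTm : 0 < T ^ m := by positivity
  calc (T ^ m)⁻¹ * 1.05 ^ T * (k:ℝ) ^ m ≤ (T ^ m)⁻¹ * 1.05 ^ T * (T ^ m * Real.exp 1) := by
        gcongr
    _ = 1.05 ^ T * Real.exp 1 := by field_simp
    _ < 1.08 ^ T := h108
    _ ≤ x ^ k := hx1

theorem one_sub_sum_le_prod_one_sub {ι : Type} (s : Finset ι) (f : ι → ℝ)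
    (h : ∀ i ∈ s, 0 ≤ f i ∧ f i ≤ 1) : 1 - ∑ i ∈ s, f i ≤ ∏ i ∈ s, (1 - f i) := by
  classical
  induction s using Finset.induction_on with
  | empty => simp
  | insert a s ha ih =>
    rw [Finset.sum_insert ha, Finset.prod_insert ha]
    have h1 := ih fun i hi => h i (Finset.mem_insert_of_mem hi)
    obtain ⟨h2, h3⟩ := h a (Finset.mem_insert_self a s)
    have h4 : 0 ≤ ∑ i ∈ s, f i :=
      Finset.sum_nonneg fun i hi => (h i (Finset.mem_insert_of_mem hi)).1
    nlinarith [mul_nonneg h2 h4, mul_le_mul_of_nonneg_left h1 (by linarith : 0 ≤ 1 - f a)]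

/-- Since `√(1-λ²) ≥ 1-λ` on `[0,1]`, the Weierstrass product inequality applies. The trace is
visibly continuous in `B`, unlike a condition on individual eigenvalues. -/
theorem one_sub_trace_le_gbsD {N : ℕ} (B : matrixSpace N) :
    1 - (B : Matrix (Fin N) (Fin N) ℝ).trace ≤ gbsD B := by
  have ht := (matrixSpace_isHermitian B).trace_eq_sum_eigenvalues
  simp only [RCLike.ofReal_real_eq_id, id] at ht
  rw [ht]
  refine (one_sub_sum_le_prod_one_sub univ _ fun i _ =>
    ⟨(eigenvalues_mem_Ioo B i).1.le, (eigenvalues_mem_Ioo B i).2.le⟩).trans ?_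
  refine Finset.prod_le_prod (fun i _ => by linarith [(eigenvalues_mem_Ioo B i).2]) fun i _ => ?_
  obtain ⟨h0, h1⟩ := eigenvalues_mem_Ioo B i
  apply Real.le_sqrt_of_sq_le
  nlinarith

/-- With `b_min ≥ 0.9/N` the squared argument of `G` is at most `(8/9)N² < (0.95N)²`, and that of
`R` is at least `4·0.3·0.9 = 1.08`. The trace bound gives `d > 0.03`, hence `1/d < 34`. -/
theorem eventually_mem_uniformSpace {ζ p : ℝ} (hζ : 0 < ζ) (hp : 0 < p) :
    ∀ᶠ N : ℕ in atTop, ∀ K : ℕ, ζ * (N : ℝ) ^ 2 ≤ K → ∀ B : matrixSpace N,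
      (∀ i j, 0.9 / (N:ℝ) ≤ (B : Matrix (Fin N) (Fin N) ℝ) i j) →
      (B : Matrix (Fin N) (Fin N) ℝ).trace < 0.97 →
      B ∈ uniformSpace N K ζ p (0.3 * N) (0.4 * N) (-2 * (N : ℝ)) (-2 * (N : ℝ)) 1 34 1.05 := by
  filter_upwards [eventually_ge_atTop 14, eventually_rFun_gt hζ] with N hN hR K hK B hB hBt
  have : NeZero N := ⟨by omega⟩
  have hNr : (14:ℝ) ≤ N := by exact_mod_cast hN
  have hN0 : (0:ℝ) < N := by linarith
  have hb := le_bmin B hB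
  have hb0 := bmin_pos B
  refine ⟨fun h => by simp at h, ?_, ?_, ?_⟩
  · rw [one_mul]
    refine gFun_lt hN K (Real.sqrt_nonneg _) ?_
    rw [Real.sqrt_le_left (by positivity)]
    rw [div_le_iff₀ hN0] at hb
    rw [← div_eq_mul_inv, div_le_iff₀ hb0]
    nlinarith
  · refine hR K hK _ ?_
    rw [div_le_iff₀ hN0] at hb
    linarith
  · have h1 := one_sub_trace_le_gbsD B
    have h2 : (0.03:ℝ) < gbsD B := by linarith
    have h3 : (1:ℝ) ≤ (N:ℝ) ^ p := Real.one_le_rpow (by linarith) hp.le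
    rw [div_lt_iff₀ (by linarith)]
    nlinarith

theorem uniformSpace_anti {N : ℕ} {K : ℕ∞} {ζ p γα γβ qα qβ CG CD CR CR' : ℝ} (hζ : 0 < ζ)
    (hCR : 0 < CR) (h : CR ≤ CR') :
    uniformSpace N K ζ p γα γβ qα qβ CG CD CR' ⊆ uniformSpace N K ζ p γα γβ qα qβ CG CD CR := by
  rintro B ⟨h1, h2, h3, h4⟩
  refine ⟨h1, h2, lt_of_le_of_lt ?_ h3, h4⟩
  gcongr

theorem dominates_neg_two_mul {ζ : ℝ} (hζ : 0 < ζ) : Dominates ζ fun N => -2 * (N : ℝ) := by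
  unfold Dominates
  have hlog : Tendsto (fun N : ℕ => Real.log (N:ℝ) / (N:ℝ)) atTop (𝓝 0) := by
    have h : Tendsto (fun x : ℝ => Real.log x / x) atTop (𝓝 0) := by
      have := (isLittleO_log_rpow_atTop (r := 1) zero_lt_one).tendsto_div_nhds_zero
      simpa using this
    exact h.comp tendsto_natCast_atTop_atTop
  have hinv : Tendsto (fun N : ℕ => (1:ℝ) / (N:ℝ)) atTop (𝓝 0) :=
    tendsto_one_div_atTop_nhds_zero_nat
  have h1 := ((hinv.const_mul (Real.log ζ)).add (hlog.const_mul 2))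
  have h2 := ((hinv.const_mul (-1 / 2)).const_add (-4)).mul h1
  simp only [mul_zero, add_zero] at h2
  refine h2.congr' ?_
  filter_upwards [eventually_ge_atTop 1] with N hN
  have hN0 : (0:ℝ) < N := by exact_mod_cast hN
  rw [Real.log_mul hζ.ne' (by positivity), Real.log_pow]
  field_simp
  push_cast
  ring

end GBS

/-! ### The open family of problems. -/

namespace GBS

open Finset Filter

/-- A well-conditioned matrix with all entries of order `1 / N`. -/
noncomputable def flatMatrix (N : ℕ) : Matrix (Fin N) (Fin N) ℝ :=
  (0.91 / (N:ℝ)) • Matrix.vecMulVec (fun _ => (1:ℝ)) (fun _ => 1) + (0.05 / (N:ℝ)) • 1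

theorem flatMatrix_apply (N : ℕ) (i j : Fin N) :
    flatMatrix N i j = 0.91 / (N:ℝ) + if i = j then 0.05 / (N:ℝ) else 0 := by
  simp [flatMatrix, Matrix.vecMulVec_apply, Matrix.one_apply]

theorem le_flatMatrix_apply {N : ℕ} (hN : 1 ≤ N) (i j : Fin N) :
    0.91 / (N:ℝ) ≤ flatMatrix N i j := by
  have hN0 : (0:ℝ) < N := by exact_mod_cast hN
  rw [flatMatrix_apply]
  have : 0 ≤ if i = j then 0.05 / (N:ℝ) else 0 := by split_ifs <;> positivity
  linarith

theorem flatMatrix_trace {N : ℕ} (hN : 1 ≤ N) : (flatMatrix N).trace = 0.96 := by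
  have hN0 : (0:ℝ) < N := by exact_mod_cast hN
  simp only [Matrix.trace, Matrix.diag_apply, flatMatrix_apply, if_true, Finset.sum_const,
    Finset.card_univ, Fintype.card_fin, nsmul_eq_mul]
  field_simp
  norm_num

theorem flatMatrix_posDef {N : ℕ} (hN : 1 ≤ N) : (flatMatrix N).PosDef := by
  have hN0 : (0:ℝ) < N := by exact_mod_cast hN
  have h1 : (Matrix.vecMulVec (fun _ => (1:ℝ)) (fun _ => 1) : Matrix (Fin N) (Fin N) ℝ).PosSemidef := by
    have := Matrix.posSemidef_vecMulVec_self_star (R := ℝ) (fun _ : Fin N => (1:ℝ))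
    simpa using this
  exact Matrix.PosDef.posSemidef_add (h1.smul (by positivity))
    (Matrix.PosDef.one.smul (by positivity))

theorem flatMatrix_mem {N : ℕ} (hN : 1 ≤ N) : flatMatrix N ∈ matrixSpace N := by
  have hN0 : (0:ℝ) < N := by exact_mod_cast hN
  have hpd := flatMatrix_posDef hN
  refine ⟨fun i j => lt_of_lt_of_le (by positivity) (le_flatMatrix_apply hN i j), hpd.isHermitian,
    fun x hx => ?_⟩
  rw [hpd.isHermitian.spectrum_real_eq_range_eigenvalues] at hx
  obtain ⟨i, rfl⟩ := hx
  refine ⟨hpd.eigenvalues_pos i, ?_⟩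
  have ht := hpd.isHermitian.trace_eq_sum_eigenvalues
  simp only [RCLike.ofReal_real_eq_id, id, flatMatrix_trace hN] at ht
  -- The eigenvalues are positive, so each is at most the trace `0.96 < 1`.
  have := Finset.single_le_sum (f := hpd.isHermitian.eigenvalues)
    (fun j _ => (hpd.eigenvalues_pos j).le) (Finset.mem_univ i)
  linarith

/-- The most balanced multi-index of degree `2k`. -/
def balanced (N k : ℕ) (i : Fin N) : ℕ := sNum N k + if (i : ℕ) < rNum N k then 1 else 0

theorem card_lt_rNum {N k : ℕ} (hN : 1 ≤ N) (hk : 1 ≤ k) :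
    #{i : Fin N | (i : ℕ) < rNum N k} = rNum N k := by
  have h := (sNum_rNum_spec hN hk).2.2
  rw [Fin.card_filter_val_lt, min_eq_right h]

theorem balanced_mem_level {N k : ℕ} (hN : 1 ≤ N) (hk : 1 ≤ k) : balanced N k ∈ level N k := by
  rw [mem_level]
  unfold balanced
  rw [Finset.sum_add_distrib, Finset.sum_const, ← Finset.card_filter, card_lt_rNum hN hk,
    Finset.card_univ, Fintype.card_fin, smul_eq_mul]
  exact (sNum_rNum_spec hN hk).1.symm

/-- For coefficients supported on balanced multi-indices, this makes the condition on `∑ a_I I!`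
equivalent to the upper bound on `∑ a_I`. -/
theorem mfact_balanced {N k : ℕ} (hN : 1 ≤ N) (hk : 1 ≤ k) : mfact (balanced N k) = mNum N k := by
  unfold mfact mNum balanced
  have : ∀ i : Fin N, ((Nat.factorial (sNum N k + if (i : ℕ) < rNum N k then 1 else 0) : ℕ) : ℝ) =
      (Nat.factorial (sNum N k) : ℝ) * if (i : ℕ) < rNum N k then (sNum N k : ℝ) + 1 else 1 := by
    intro i
    split_ifs
    · rw [Nat.factorial_succ]; push_cast; ring
    · simp
  simp_rw [this]
  rw [Finset.prod_mul_distrib, ← Finset.prod_filter, Finset.prod_const, Finset.prod_const,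
    card_lt_rNum hN hk, Finset.card_univ, Fintype.card_fin]

open Classical in
/-- Coefficients supported on the balanced multi-indices, with value `v k` in degree `2k`. -/
noncomputable def balancedCoeff (N : ℕ) (K : ℕ∞) (t : ℝ≥0) (v : ℕ → ℝ≥0) : CoeffSpace N K :=
  fun I => if I.1 = 0 then t else if I.1 = balanced N ((∑ i, I.1 i) / 2) then
    v ((∑ i, I.1 i) / 2) else 0

theorem coeff_of_mem_level {N : ℕ} {K : ℕ∞} (a : CoeffSpace N K) {k : ℕ} (hk : (k : ℕ∞) ≤ K)
    {I : Fin N → ℕ} (hI : I ∈ level N k) : coeff a I = a ⟨I, k, hk, mem_level.mp hI⟩ :=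
  dif_pos ⟨k, hk, mem_level.mp hI⟩

theorem coeff_balancedCoeff_zero (N : ℕ) (K : ℕ∞) (t : ℝ≥0) (v : ℕ → ℝ≥0) :
    coeff (balancedCoeff N K t v) 0 = t := by
  rw [coeff_of_mem_level _ (k := 0) (by simp) (by simp [level_zero])]
  simp [balancedCoeff]

theorem sum_level_balancedCoeff {N : ℕ} {K : ℕ∞} (hN : 1 ≤ N) (t : ℝ≥0) (v : ℕ → ℝ≥0) {k : ℕ}
    (hk : 1 ≤ k) (hkK : (k : ℕ∞) ≤ K) (g : (Fin N → ℕ) → ℝ) :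
    ∑ I ∈ level N k, coeff (balancedCoeff N K t v) I * g I = v k * g (balanced N k) := by
  classical
  have h0 : ∀ I ∈ level N k, coeff (balancedCoeff N K t v) I =
      if I = balanced N k then (v k : ℝ) else 0 := by
    intro I hI
    rw [coeff_of_mem_level _ hkK hI]
    have hI' := mem_level.mp hI
    have hne : I ≠ 0 := by
      rintro rfl
      simp at hI'
      omega
    have hd : (∑ i, I i) / 2 = k := by omega
    simp only [balancedCoeff, if_neg hne, hd]
    split_ifs <;> rfl
  rw [Finset.sum_eq_single (balanced N k)]
  · rw [h0 _ (balanced_mem_level hN hk), if_pos rfl]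
  · intro I hI hne
    rw [h0 I hI, if_neg hne, zero_mul]
  · intro h
    exact absurd (balanced_mem_level hN hk) h

theorem mem_problemSpace {N K : ℕ} (hN : 1 ≤ N) (B : matrixSpace N) (a : CoeffSpace N (K : ℕ∞))
    (ha : 0 < coeff a 0) : (B, a) ∈ problemSpace N (K : ℕ∞) := by
  classical
  have : NeZero N := ⟨by omega⟩
  set L := (Finset.range (K + 1)).biUnion fun k => level N k with hL
  have hout : ∀ I, I ∉ L → coeff a I = 0 := by
    intro I hI
    by_contra hne
    obtain ⟨k, hk, hIk⟩ := exists_of_coeff_ne_zero hne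
    have hk : k ≤ K := by exact_mod_cast hk
    exact hI (Finset.mem_biUnion.mpr ⟨k, Finset.mem_range.mpr (by omega), mem_level.mpr hIk⟩)
  have h1 : Summable fun I : Fin N → ℕ =>
      coeff a I * hafB (B : Matrix (Fin N) (Fin N) ℝ) I :=
    summable_of_ne_finset_zero (s := L) fun I hI => by rw [hout I hI, zero_mul]
  refine ⟨h1, ?_, ?_, ?_⟩
  · exact (ha.trans_le (coeff_zero_le_muHaf h1)).ne'
  · exact summable_of_ne_finset_zero (s := L) fun I hI => by simp [hout I hI]
  · refine summable_of_ne_finset_zero (s := L ×ˢ L) fun p hp => ?_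
    rw [Finset.mem_product, not_and_or] at hp
    rcases hp with hp | hp
    · simp [hout _ hp]
    · simp [hout _ hp]

theorem continuous_coeff {N : ℕ} {K : ℕ∞} (I : Fin N → ℕ) :
    Continuous fun a : CoeffSpace N K => coeff a I := by
  unfold coeff
  split_ifs with h
  · exact NNReal.continuous_coe.comp (continuous_apply _)
  · exact continuous_const

/-- Well-conditioned matrices whose entries are at least of order `1 / N`, with coefficients
strictly inside the growth conditions. -/
def wellConditioned (N K : ℕ) (l u γα γβ q : ℝ) : Set (problemSpace N (K : ℕ∞)) :=
  {x | (∀ i j, 0.9 / (N:ℝ) < (x.1.1 : Matrix (Fin N) (Fin N) ℝ) i j) ∧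
    (x.1.1 : Matrix (Fin N) (Fin N) ℝ).trace < 0.97 ∧ l < coeff x.1.2 0 ∧ coeff x.1.2 0 < u ∧
    ∀ k ∈ Icc 1 K, (k : ℝ) ^ q * γα ^ k / (Nat.factorial k : ℝ) < ∑ I ∈ level N k, coeff x.1.2 I ∧
      ∑ I ∈ level N k, coeff x.1.2 I < (k : ℝ) ^ q * γβ ^ k / (Nat.factorial k : ℝ) ∧
      ∑ I ∈ level N k, coeff x.1.2 I * mfact I <
        (k : ℝ) ^ q * γβ ^ k / (Nat.factorial k : ℝ) * mNum N k}

theorem isOpen_wellConditioned (N K : ℕ) (l u γα γβ q : ℝ) :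
    IsOpen (wellConditioned N K l u γα γβ q) := by
  have hB : Continuous fun x : problemSpace N (K : ℕ∞) =>
      (x.1.1 : Matrix (Fin N) (Fin N) ℝ) :=
    continuous_subtype_val.comp (continuous_fst.comp continuous_subtype_val)
  have ha : ∀ I, Continuous fun x : problemSpace N (K : ℕ∞) => coeff x.1.2 I := fun I =>
    (continuous_coeff I).comp (continuous_snd.comp continuous_subtype_val)
  have hs : ∀ k, Continuous fun x : problemSpace N (K : ℕ∞) => ∑ I ∈ level N k, coeff x.1.2 I :=
    fun k => continuous_finsetSum _ fun I _ => ha I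
  have hm : ∀ k, Continuous fun x : problemSpace N (K : ℕ∞) =>
      ∑ I ∈ level N k, coeff x.1.2 I * mfact I :=
    fun k => continuous_finsetSum _ fun I _ => (ha I).mul continuous_const
  have e : wellConditioned N K l u γα γβ q =
      (⋂ i, ⋂ j, {x : problemSpace N (K : ℕ∞) |
        0.9 / (N:ℝ) < (x.1.1 : Matrix (Fin N) (Fin N) ℝ) i j}) ∩
      ({x | (x.1.1 : Matrix (Fin N) (Fin N) ℝ).trace < 0.97} ∩ ({x | l < coeff x.1.2 0} ∩
      ({x | coeff x.1.2 0 < u} ∩ ⋂ k ∈ Icc 1 K,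
        ({x | (k : ℝ) ^ q * γα ^ k / (Nat.factorial k : ℝ) < ∑ I ∈ level N k, coeff x.1.2 I} ∩
        ({x | ∑ I ∈ level N k, coeff x.1.2 I < (k : ℝ) ^ q * γβ ^ k / (Nat.factorial k : ℝ)} ∩
        {x | ∑ I ∈ level N k, coeff x.1.2 I * mfact I <
          (k : ℝ) ^ q * γβ ^ k / (Nat.factorial k : ℝ) * mNum N k}))))) := by
    ext x
    simp only [wellConditioned, Set.mem_ofPred_eq, Set.mem_inter_iff, Set.mem_iInter]
  rw [e]
  refine IsOpen.inter ?_ (IsOpen.inter ?_ (IsOpen.inter ?_ (IsOpen.inter ?_ ?_)))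
  · exact isOpen_iInter_of_finite fun i => isOpen_iInter_of_finite fun j =>
      isOpen_lt continuous_const (hB.matrix_elem i j)
  · exact isOpen_lt hB.matrix_trace continuous_const
  · exact isOpen_lt continuous_const (ha 0)
  · exact isOpen_lt (ha 0) continuous_const
  · refine isOpen_biInter_finset fun k _ => IsOpen.inter ?_ (IsOpen.inter ?_ ?_)
    · exact isOpen_lt continuous_const (hs k)
    · exact isOpen_lt (hs k) continuous_const
    · exact isOpen_lt (hm k) continuous_const

theorem exists_mem_wellConditioned {N K : ℕ} (hN : 1 ≤ N) {l u γα γβ q t : ℝ} (hl : 0 ≤ l)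
    (hγα : 0 < γα) (hγ : γα < γβ) (hlt : l < t) (htu : t < u) :
    ∃ x ∈ wellConditioned N K l u γα γβ q, coeff x.1.2 0 = t := by
  have hN0 : (0:ℝ) < N := by exact_mod_cast hN
  have ht : 0 < t := hl.trans_lt hlt
  -- A rate strictly between `γ_α` and `γ_β` makes all growth conditions strict, as the open set
  -- requires.
  set γ := (γα + γβ) / 2 with hγdef
  have h1 : γα < γ := by rw [hγdef]; linarith
  have h2 : γ < γβ := by rw [hγdef]; linarith
  have hγ0 : 0 < γ := hγα.trans h1
  set v : ℕ → ℝ≥0 := fun k =>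
    ⟨(k : ℝ) ^ q * γ ^ k / (Nat.factorial k : ℝ), by positivity⟩ with hv
  have hvk : ∀ k, (v k : ℝ) = (k : ℝ) ^ q * γ ^ k / (Nat.factorial k : ℝ) := fun k => rfl
  set a := balancedCoeff N (K : ℕ∞) ⟨t, ht.le⟩ v with ha
  have ha0 : coeff a 0 = t := coeff_balancedCoeff_zero N _ _ v
  refine ⟨⟨(⟨flatMatrix N, flatMatrix_mem hN⟩, a), mem_problemSpace hN _ a (by rw [ha0]; exact ht)⟩,
    ⟨?_, ?_, by rw [ha0]; exact hlt, by rw [ha0]; exact htu, ?_⟩, ha0⟩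
  · intro i j
    refine lt_of_lt_of_le ?_ (le_flatMatrix_apply hN i j)
    gcongr
    norm_num
  · simp only [flatMatrix_trace hN]
    norm_num
  · intro k hk
    rw [Finset.mem_Icc] at hk
    have hkK : (k : ℕ∞) ≤ (K : ℕ∞) := by exact_mod_cast hk.2
    have hk0 : (0:ℝ) < k := by exact_mod_cast hk.1
    have e1 := sum_level_balancedCoeff hN ⟨t, ht.le⟩ v hk.1 hkK fun _ => 1
    have e2 := sum_level_balancedCoeff hN ⟨t, ht.le⟩ v hk.1 hkK mfact
    simp only [mul_one] at e1
    rw [e1, e2, hvk, mfact_balanced hN hk.1]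
    have hm : 0 < mNum N k := by unfold mNum; positivity
    have hk1 : k ≠ 0 := by omega
    refine ⟨?_, ?_, ?_⟩ <;> gcongr

theorem exists_open_family (ζ p : ℝ) (hζ : 0 < ζ) (hp : 0 < p) :
    ∃ (CG CD CR : ℝ) (γα γβ qα qβ : ℕ → ℝ),
      0 < CG ∧ 0 < CD ∧ 1 < CR ∧ Dominates ζ qα ∧ (∀ N, 1 ≤ N → 0 < γα N ∧ 0 < γβ N) ∧
      ∀ l u : ℝ, 0 < l → l < u →
        ∃ (C c : ℝ) (N₀ : ℕ), 0 < C ∧ 0 < c ∧ 1 ≤ N₀ ∧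
          ∀ N K : ℕ, N₀ ≤ N → ζ * (N : ℝ) ^ 2 ≤ (K : ℝ) →
            ∃ U : Set (problemSpace N (K : ℕ∞)), IsOpen U ∧ U.Nonempty ∧
              (∀ t, l < t → t < u → ∃ x ∈ U, coeff x.1.2 0 = t) ∧
              ∀ x ∈ U,
                x.1.1 ∈ uniformSpace N (K : ℕ∞) ζ p (γα N) (γβ N) (qα N) (qβ N) CG CD CR ∧
                CoeffBounds (γα N) (γβ N) (qα N) (qβ N) x.1.2 ∧
                l < coeff x.1.2 0 ∧ coeff x.1.2 0 < u ∧
                ∀ ε δ : ℝ, 0 < ε → ε < 1 → 0 < δ → δ < 1 →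
                  nGBSP ε δ x.1.1 x.1.2 ≤ 1 / (ε ^ 2 * δ) * (C * (N : ℝ) ^ (3 + p)) ∧
                  1 / (ε ^ 2 * δ) * (c * CR ^ (ζ * (N : ℝ) ^ 2)) ≤
                    nMC ε δ x.1.1 x.1.2 := by
  -- The growth theorem needs `ρ < C_R`. The matrices satisfy the condition on `R` with base `1.05`,
  -- while `1.02` is declared as `C_R`; the theorem is applied to the former with `ρ = 1.02`.
  refine ⟨1, 34, 1.02, fun N => 0.3 * N, fun N => 0.4 * N, fun N => -2 * (N : ℝ),
    fun N => -2 * (N : ℝ), one_pos, by norm_num, by norm_num, dominates_neg_two_mul hζ,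
    fun N hN => ?_, fun l u hl hlu => ?_⟩
  · have hN0 : (0:ℝ) < N := by exact_mod_cast hN
    constructor <;> positivity
  obtain ⟨C, hC, hgrow⟩ := sample_size_growth ζ p 1 34 1.05 l u (fun N => -2 * (N : ℝ)) hζ
    one_pos (by norm_num) (by norm_num) hl hlu.le (dominates_neg_two_mul hζ)
  obtain ⟨c, N₁, hc, hN₁, hgrow⟩ := hgrow 1.02 (by norm_num) (by norm_num)
  obtain ⟨N₂, hN₂⟩ := eventually_atTop.mp (eventually_mem_uniformSpace hζ hp)
  refine ⟨C, c, max N₁ N₂, hC, hc, hN₁.trans (le_max_left _ _), fun N K hN hK => ?_⟩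
  have hN1 : N₁ ≤ N := (le_max_left _ _).trans hN
  have hNpos : 1 ≤ N := hN₁.trans hN1
  have hN0 : (0:ℝ) < N := by exact_mod_cast hNpos
  have hatt : ∀ t, l < t → t < u → ∃ x ∈ wellConditioned N K l u (0.3 * N) (0.4 * N)
      (-2 * (N : ℝ)), coeff x.1.2 0 = t := fun t hlt htu =>
    exists_mem_wellConditioned hNpos hl.le (by positivity) (by linarith) hlt htu
  refine ⟨wellConditioned N K l u (0.3 * N) (0.4 * N) (-2 * (N : ℝ)),
    isOpen_wellConditioned _ _ _ _ _ _ _, ?_, hatt, ?_⟩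
  · obtain ⟨x, hx, -⟩ := hatt ((l + u) / 2) (by linarith) (by linarith)
    exact ⟨x, hx⟩
  · rintro x ⟨hxB, hxt, hxl, hxu, hxa⟩
    have hmem := hN₂ N ((le_max_right _ _).trans hN) K hK x.1.1 (fun i j => (hxB i j).le) hxt
    have hcb : CoeffBounds (0.3 * (N:ℝ)) (0.4 * (N:ℝ)) (-2 * (N : ℝ)) (-2 * (N : ℝ)) x.1.2 := by
      intro k hk hkK
      have hkK : k ≤ K := by exact_mod_cast hkK
      obtain ⟨h1, h2, h3⟩ := hxa k (Finset.mem_Icc.mpr ⟨hk, hkK⟩)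
      exact ⟨h1.le, h2.le, h3.le⟩
    refine ⟨uniformSpace_anti hζ (by norm_num) (by norm_num) hmem, hcb, hxl, hxu, ?_⟩
    intro ε δ hε hε1 hδ hδ1
    exact hgrow N K ε δ (0.3 * N) (0.4 * N) (-2 * N) hN1 (Or.inr (by simpa using hK)) hε hε1 hδ hδ1
      (by positivity) (by positivity) x.1.1 x.1.2 x.2 hmem hcb hxl.le hxu.le

end GBS

theorem mainTheorem6 :
    -- the explicit bounds, for each single `N`
    (∀ (N : ℕ) (K : ℕ∞) (ζ p ε δ γα γβ qα qβ CG CD CR : ℝ),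
      1 ≤ N → 0 < ζ → LargeDegree ζ N K → 0 < p → 0 < ε → ε < 1 → 0 < δ → δ < 1 →
      0 < γα → 0 < γβ → 0 < CG → 0 < CD → 1 < CR →
      ∀ (B : matrixSpace N) (a : CoeffSpace N K), (B, a) ∈ problemSpace N K →
        B ∈ uniformSpace N K ζ p γα γβ qα qβ CG CD CR →
        CoeffBounds γα γβ qα qβ a → coeff a 0 ≠ 0 →
        nGBSP ε δ B a <
          1 / (ε ^ 2 * δ) *
            (CD * (N : ℝ) ^ p + CG * CD * (N : ℝ) ^ (3 + p) / coeff a 0 - 1) ∧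
        1 / (ε ^ 2 * δ) *
            (min 1 (coeff a 0) * (Real.exp (1 / 25 - 1 / 6) / √Real.pi) *
                (ζ * (N : ℝ) ^ 2) ^ (2 * qα - 1 / 2) * CR ^ (ζ * (N : ℝ) ^ 2) /
              (CD * (N : ℝ) ^ p * (coeff a 0 + CG * (N : ℝ) ^ 3)) ^ 2 - 1) <
          nMC ε δ B a) ∧
    -- the growth rates along families of problems
    (∀ (ζ p CG CD CR l u : ℝ) (qα : ℕ → ℝ),
      0 < ζ → 0 < p → 0 < CG → 0 < CD → 1 < CR → 0 < l → l ≤ u → Dominates ζ qα →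
      ∃ C : ℝ, 0 < C ∧ ∀ ρ : ℝ, 1 < ρ → ρ < CR →
      ∃ (c : ℝ) (N₀ : ℕ), 0 < c ∧ 1 ≤ N₀ ∧
        ∀ (N : ℕ) (K : ℕ∞) (ε δ γα γβ qβ : ℝ),
          N₀ ≤ N → LargeDegree ζ N K → 0 < ε → ε < 1 → 0 < δ → δ < 1 → 0 < γα → 0 < γβ →
          ∀ (B : matrixSpace N) (a : CoeffSpace N K), (B, a) ∈ problemSpace N K →
            B ∈ uniformSpace N K ζ p γα γβ (qα N) qβ CG CD CR →
            CoeffBounds γα γβ (qα N) qβ a → l ≤ coeff a 0 → coeff a 0 ≤ u →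
            nGBSP ε δ B a ≤ 1 / (ε ^ 2 * δ) * (C * (N : ℝ) ^ (3 + p)) ∧
            1 / (ε ^ 2 * δ) * (c * ρ ^ (ζ * (N : ℝ) ^ 2)) ≤ nMC ε δ B a) ∧
    -- for all large `N` there are non-empty open subsets of the problem space of such problems
    (∀ ζ p : ℝ, 0 < ζ → 0 < p →
      ∃ (CG CD CR : ℝ) (γα γβ qα qβ : ℕ → ℝ),
        0 < CG ∧ 0 < CD ∧ 1 < CR ∧ Dominates ζ qα ∧ (∀ N, 1 ≤ N → 0 < γα N ∧ 0 < γβ N) ∧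
        ∀ l u : ℝ, 0 < l → l < u →
          ∃ (C c : ℝ) (N₀ : ℕ), 0 < C ∧ 0 < c ∧ 1 ≤ N₀ ∧
            ∀ N K : ℕ, N₀ ≤ N → ζ * (N : ℝ) ^ 2 ≤ (K : ℝ) →
              ∃ U : Set (problemSpace N (K : ℕ∞)), IsOpen U ∧ U.Nonempty ∧
                (∀ t, l < t → t < u → ∃ x ∈ U, coeff x.1.2 0 = t) ∧
                ∀ x ∈ U,
                  x.1.1 ∈ uniformSpace N (K : ℕ∞) ζ p (γα N) (γβ N) (qα N) (qβ N) CG CD CR ∧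
                  CoeffBounds (γα N) (γβ N) (qα N) (qβ N) x.1.2 ∧
                  l < coeff x.1.2 0 ∧ coeff x.1.2 0 < u ∧
                  ∀ ε δ : ℝ, 0 < ε → ε < 1 → 0 < δ → δ < 1 →
                    nGBSP ε δ x.1.1 x.1.2 ≤ 1 / (ε ^ 2 * δ) * (C * (N : ℝ) ^ (3 + p)) ∧
                    1 / (ε ^ 2 * δ) * (c * CR ^ (ζ * (N : ℝ) ^ 2)) ≤
                      nMC ε δ x.1.1 x.1.2) := by
  refine ⟨?_, ?_, exists_open_family⟩
  · intro N K ζ p ε δ γα γβ qα qβ CG CD CR hN hζ _ _ hε _ hδ _ hγα hγβ hCG hCD hCR B a hP hB ha ha0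
    exact sample_size_bounds N K ζ p ε δ γα γβ qα qβ CG CD CR hN hε hδ hγα hγβ hCG hCD hζ hCR
      B a hP hB ha ha0
  · intro ζ p CG CD CR l u qα hζ _ hCG hCD hCR hl hlu hq
    exact sample_size_growth ζ p CG CD CR l u qα hζ hCG hCD hCR hl hlu hq
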